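/- Let $\mathfrak g$ be a real Lie algebra. For $\alpha\in\mathfrak g^*$ put $d\alpha(X,Y)=-\alpha([X,Y])$, and extend $d$ to all forms on $\mathfrak g$ as the Chevalley–Eilenberg differential. For a basis $E_1,\dots,E_5$ of $\mathfrak g$ with dual basis $e^1,\dots,e^5$ of $\mathfrak g^*$ write $e^{ij}=e^i\wedge e^j$. Write $\mathfrak g^0=\mathfrak g$, $\mathfrak g^{k+1}=[\mathfrak g^k,\mathfrak g^k]$ for the derived series, $\mathbb R^*=\mathbb R\setminus\{0\}$, and $\langle\cdots\rangle$ for the linear span. A *hypo-contact structure* on a $5$-dimensional Lie algebra $\mathfrak g$ consists of $\eta\in\mathfrak g^*$ and $2$-forms $\omega_1,\omega_2,\omega_3$ on $\mathfrak g$ such that $\omega_i\wedge\omega_j=\delta_{ij}v$ for some $4$-form $v$ with $v\wedge\eta\neq0$; $i_X\omega_3=i_Y\omega_1$ implies $\omega_2(X,Y)\ge0$; and $d\eta=-2\omega_3$, $d(\eta\wedge\omega_1)=0$, $d(\eta\wedge\omega_2)=0$. A basis is *adapted* to it if $$\eta=e^5,\quad \omega_1=e^{12}+e^{34},\quad \omega_2=e^{13}+e^{42},\quad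 \omega_3=e^{14}+e^{23}.$$ **Proposition.** Let $\mathfrak g$ be a solvable real Lie algebra of dimension $5$ with a hypo-contact structure $(\eta,\omega_1,\omega_2,\omega_3)$ and an adapted basis satisfying, for some real numbers $A,B_{ij},C_{ij},D_{15}$, $$\begin{aligned} de^1&=Ae^{14}+Ae^{23},\\ de^2&=B_{12}e^{12}+B_{13}e^{13}+B_{14}e^{14}+B_{15}e^{15}-B_{14}e^{23}+(2A+B_{13})e^{24}+B_{25}e^{25}+B_{34}e^{34}+B_{35}e^{35},\\ de^3&=(3A+B_{13})e^{12}+C_{13}e^{13}+C_{14}e^{14}+C_{15}e^{15}-C_{14}e^{23}-(B_{12}+B_{34}-C_{13})e^{24}+C_{25}e^{25}-(A+B_{13})e^{34}-B_{25}e^{35},\\ de^4&=B_{14}e^{12}+C_{14}e^{13}+(B_{34}-C_{13})e^{14}+D_{15}e^{15}+(B_{12}+C_{13})e^{23}+C_{14}e^{24}+C_{15}e^{25}-B_{14}e^{34}-B_{15}e^{35},\\ de^5&=-2e^{14}-2e^{23}. \end{aligned}$$ Then there is a basis of $\mathfrak g$, adapted to the same structure $(\eta,\omega_1,\omega_2,\omega_3)$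 (and again denoted $E_1,\dots,E_5$, with dual basis $e^1,\dots,e^5$), in which the structure equations are those of one of the six families below; in each of them $de^5=-2e^{14}-2e^{23}$. Moreover, whenever some basis of $\mathfrak g$ satisfies the equations of a family, the derived series is as stated for that family. 1. ($r\in\mathbb R^*$) $de^1=0$, $de^2=re^{12}$, $de^3=re^{13}$, $de^4=-re^{14}-3r^2e^{15}+2re^{23}$. Then $\mathfrak g^1=\langle E_2,E_3,E_4,E_5\rangle$, $\mathfrak g^2=\langle rE_4-E_5\rangle$, $\mathfrak g^3=0$. 2. ($r\in\mathbb R^*$) $de^1=0$, $de^2=re^{12}+3re^{34}+3r^2e^{35}$, $de^3=re^{13}-3re^{24}-3r^2e^{25}$, $de^4=-r\,de^5$. Then $\mathfrak g^1=\langle E_2,E_3,rE_4-E_5\rangle$, $\mathfrak g^2=\langle rE_4-E_5\rangle$, $\mathfrak g^3=0$. 3. ($a\in\mathbb R$, $r\in\mathbb R^*$) $de^1=0$, $de^2=re^{14}-re^{23}-ar\,e^{25}+r^2e^{35}$, $de^3=\frac ar\,de^2$, $de^4=re^{12}+ae^{13}-(a^2+r^2)e^{15}+ae^{24}-re^{34}$.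 Then $\mathfrak g^1=\langle rE_2+aE_3,E_4,E_5\rangle$, $\mathfrak g^2=0$. 4. ($a,b\in\mathbb R$) $de^1=de^2=0$, $de^3=ae^{13}+be^{14}-be^{23}+ae^{24}-(a^2+b^2)e^{25}$, $de^4=be^{13}-ae^{14}-(a^2+b^2)e^{15}+ae^{23}+be^{24}$. If $a$ or $b$ is nonzero, then $\mathfrak g^1=\langle E_3,E_4,E_5\rangle$, $\mathfrak g^2=0$. 5. ($r\in\mathbb R^*$) $de^1=0$, $de^2=re^{34}+\frac{r^2}2e^{35}$, $de^3=re^{13}$, $de^4=-\frac{r^2}2e^{15}+re^{23}$. Then $\mathfrak g^1=\langle E_2,E_3,E_4,E_5\rangle$, $\mathfrak g^2=\langle E_2,rE_4-2E_5\rangle$, $\mathfrak g^3=0$. 6. ($r\in\mathbb R^*$, $a\in\mathbb R$) $de^1=0$, $$\begin{aligned} de^2&=re^{12}+ae^{13}+ae^{24}+\tfrac a{2r}(r^2+a^2)e^{25}+\tfrac{a^2}re^{34}+\tfrac{a^2}{2r^2}(r^2+a^2)e^{35},\\ de^3&=ae^{12}+\tfrac{a^2}re^{13}-re^{24}-\tfrac12(r^2+a^2)e^{25}-ae^{34}-\tfrac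 a{2r}(r^2+a^2)e^{35},\\ de^4&=-\tfrac{(r^2+a^2)^2}{2r^2}e^{15}+\tfrac{r^2+a^2}re^{23}. \end{aligned}$$ Then $\mathfrak g^1=\langle E_2,E_3,E_4,E_5\rangle$, $\mathfrak g^2=\langle aE_2-rE_3,(r^2+a^2)E_4-2rE_5\rangle$, $\mathfrak g^3=0$. -/

import Mathlib

namespace HypoContact

open Module

section Forms

variable {g : Type*} [LieRing g] [LieAlgebra ℝ g]

/-- The wedge product `α ∧ β` of two 1-forms. A 1-form is a linear functional, a 2-form is an
alternating bilinear form; both are regarded as left-invariant forms. -/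
def wedge (α β : Dual ℝ g) : LinearMap.BilinForm ℝ g :=
  LinearMap.mk₂ ℝ (fun x y => α x * β y - α y * β x)
    (by intros; simp only [map_add]; ring)
    (by intros; simp only [map_smul, smul_eq_mul]; ring)
    (by intros; simp only [map_add]; ring)
    (by intros; simp only [map_smul, smul_eq_mul]; ring)

/-- The Chevalley–Eilenberg differential of a 1-form: `dα(x, y) = -α([x, y])`. -/
def d (α : Dual ℝ g) : LinearMap.BilinForm ℝ g :=
  LinearMap.mk₂ ℝ (fun x y => -α ⁅x, y⁆)
    (by intros; simp only [add_lie, map_add]; ring)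
    (by intros; simp only [smul_lie, map_smul, smul_eq_mul]; ring)
    (by intros; simp only [lie_add, map_add]; ring)
    (by intros; simp only [lie_smul, map_smul, smul_eq_mul]; ring)

/-- The 3-form `η ∧ ω` for a 1-form `η` and a 2-form `ω` (sum over shuffles). -/
def wedge₁₂ (η : Dual ℝ g) (ω : LinearMap.BilinForm ℝ g) (x y z : g) : ℝ :=
  η x * ω y z - η y * ω x z + η z * ω x y

/-- The 4-form `ω ∧ σ` for 2-forms `ω` and `σ` (sum over shuffles). -/
def wedge₂₂ (ω σ : LinearMap.BilinForm ℝ g) (x y z w : g) : ℝ :=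
  ω x y * σ z w - ω x z * σ y w + ω x w * σ y z
    + ω y z * σ x w - ω y w * σ x z + ω z w * σ x y

/-- The 5-form `v ∧ η` for a 4-form `v` and a 1-form `η` (sum over shuffles). -/
def wedge₄₁ (v : g → g → g → g → ℝ) (η : Dual ℝ g) (x y z w u : g) : ℝ :=
  η x * v y z w u - η y * v x z w u + η z * v x y w u - η w * v x y z u + η u * v x y z w

/-- The Chevalley–Eilenberg differential of a 3-form. -/
def d₃ (φ : g → g → g → ℝ) (x y z w : g) : ℝ :=
  - φ ⁅x, y⁆ z w + φ ⁅x, z⁆ y w - φ ⁅x, w⁆ y z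
    - φ ⁅y, z⁆ x w + φ ⁅y, w⁆ x z - φ ⁅z, w⁆ x y

/-- `(η, ω₁, ω₂, ω₃)` is an `SU(2)`-structure on the 5-dimensional Lie algebra `g`:
`ωᵢ ∧ ωⱼ = δᵢⱼ v` for some 4-form `v` with `v ∧ η ≠ 0`, and
`i_X ω₃ = i_Y ω₁` implies `ω₂(X, Y) ≥ 0`. -/
structure IsSU2Structure (η : Dual ℝ g) (ω₁ ω₂ ω₃ : LinearMap.BilinForm ℝ g) : Prop where
  alt₁ : ω₁.IsAlt
  alt₂ : ω₂.IsAlt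
  alt₃ : ω₃.IsAlt
  exists_volume : ∃ v : g → g → g → g → ℝ,
    wedge₂₂ ω₁ ω₁ = v ∧ wedge₂₂ ω₂ ω₂ = v ∧ wedge₂₂ ω₃ ω₃ = v ∧
    wedge₂₂ ω₁ ω₂ = 0 ∧ wedge₂₂ ω₁ ω₃ = 0 ∧ wedge₂₂ ω₂ ω₃ = 0 ∧
    wedge₄₁ v η ≠ 0
  nonneg : ∀ X Y : g, ω₃ X = ω₁ Y → 0 ≤ ω₂ X Y

/-- A hypo-contact structure: an `SU(2)`-structure with `dη = -2ω₃`, `d(η ∧ ω₁) = 0` and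
`d(η ∧ ω₂) = 0`. -/
structure IsHypoContact (η : Dual ℝ g) (ω₁ ω₂ ω₃ : LinearMap.BilinForm ℝ g) : Prop
    extends IsSU2Structure η ω₁ ω₂ ω₃ where
  d_eta : d η = (-2 : ℝ) • ω₃
  d_eta_wedge₁ : d₃ (wedge₁₂ η ω₁) = 0
  d_eta_wedge₂ : d₃ (wedge₁₂ η ω₂) = 0

end Forms

section Bases

/-! Bases `E₁, …, E₅` of `g` are indexed by `Fin 5`, whose elements are the residues
`1, 2, 3, 4, 5 = 0`: as indices the numerals `1, …, 5` are pairwise distinct and exhaust `Fin 5`. -/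

variable {g : Type*} [LieRing g] [LieAlgebra ℝ g]

/-- `eⁱ`, the basis of `g*` dual to the basis `E` of `g`. -/
noncomputable def e (E : Basis (Fin 5) ℝ g) (i : Fin 5) : Dual ℝ g := E.coord i

/-- `eⁱʲ = eⁱ ∧ eʲ`. -/
noncomputable def ee (E : Basis (Fin 5) ℝ g) (i j : Fin 5) : LinearMap.BilinForm ℝ g := wedge (e E i) (e E j)

/-- The basis is adapted to the structure:
`η = e⁵`, `ω₁ = e¹² + e³⁴`, `ω₂ = e¹³ + e⁴²`, `ω₃ = e¹⁴ + e²³`. -/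
structure IsAdapted (E : Basis (Fin 5) ℝ g) (η : Dual ℝ g)
    (ω₁ ω₂ ω₃ : LinearMap.BilinForm ℝ g) : Prop where
  eta : η = e E 5
  omega₁ : ω₁ = ee E 1 2 + ee E 3 4
  omega₂ : ω₂ = ee E 1 3 + ee E 4 2
  omega₃ : ω₃ = ee E 1 4 + ee E 2 3

/-- The general structure equations. (The coefficients satisfy `d(deⁱ) = 0` because of the
Jacobi identity in `g`.) -/
def GeneralEquations (E : Basis (Fin 5) ℝ g) : Prop :=
  ∃ A B₁₂ B₁₃ B₁₄ B₁₅ B₂₅ B₃₄ B₃₅ C₁₃ C₁₄ C₁₅ C₂₅ D₁₅ : ℝ,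
    d (e E 1) = A • ee E 1 4 + A • ee E 2 3 ∧
    d (e E 2) = B₁₂ • ee E 1 2 + B₁₃ • ee E 1 3 + B₁₄ • ee E 1 4 + B₁₅ • ee E 1 5
      - B₁₄ • ee E 2 3 + (2 * A + B₁₃) • ee E 2 4 + B₂₅ • ee E 2 5 + B₃₄ • ee E 3 4
      + B₃₅ • ee E 3 5 ∧
    d (e E 3) = (3 * A + B₁₃) • ee E 1 2 + C₁₃ • ee E 1 3 + C₁₄ • ee E 1 4 + C₁₅ • ee E 1 5
      - C₁₄ • ee E 2 3 - (B₁₂ + B₃₄ - C₁₃) • ee E 2 4 + C₂₅ • ee E 2 5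
      - (A + B₁₃) • ee E 3 4 - B₂₅ • ee E 3 5 ∧
    d (e E 4) = B₁₄ • ee E 1 2 + C₁₄ • ee E 1 3 + (B₃₄ - C₁₃) • ee E 1 4 + D₁₅ • ee E 1 5
      + (B₁₂ + C₁₃) • ee E 2 3 + C₁₄ • ee E 2 4 + C₁₅ • ee E 2 5 - B₁₄ • ee E 3 4
      - B₁₅ • ee E 3 5 ∧
    d (e E 5) = (-2 : ℝ) • ee E 1 4 - (2 : ℝ) • ee E 2 3

/-! The six families of structure equations. -/

def Family1 (E : Basis (Fin 5) ℝ g) (r : ℝ) : Prop :=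
  d (e E 1) = 0 ∧
  d (e E 2) = r • ee E 1 2 ∧
  d (e E 3) = r • ee E 1 3 ∧
  d (e E 4) = -r • ee E 1 4 - (3 * r ^ 2) • ee E 1 5 + (2 * r) • ee E 2 3 ∧
  d (e E 5) = (-2 : ℝ) • ee E 1 4 - (2 : ℝ) • ee E 2 3

def Family2 (E : Basis (Fin 5) ℝ g) (r : ℝ) : Prop :=
  d (e E 1) = 0 ∧
  d (e E 2) = r • ee E 1 2 + (3 * r) • ee E 3 4 + (3 * r ^ 2) • ee E 3 5 ∧
  d (e E 3) = r • ee E 1 3 - (3 * r) • ee E 2 4 - (3 * r ^ 2) • ee E 2 5 ∧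
  d (e E 4) = -r • d (e E 5) ∧
  d (e E 5) = (-2 : ℝ) • ee E 1 4 - (2 : ℝ) • ee E 2 3

def Family3 (E : Basis (Fin 5) ℝ g) (a r : ℝ) : Prop :=
  d (e E 1) = 0 ∧
  d (e E 2) = r • ee E 1 4 - r • ee E 2 3 - (a * r) • ee E 2 5 + r ^ 2 • ee E 3 5 ∧
  d (e E 3) = (a / r) • d (e E 2) ∧
  d (e E 4) = r • ee E 1 2 + a • ee E 1 3 - (a ^ 2 + r ^ 2) • ee E 1 5 + a • ee E 2 4
    - r • ee E 3 4 ∧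
  d (e E 5) = (-2 : ℝ) • ee E 1 4 - (2 : ℝ) • ee E 2 3

def Family4 (E : Basis (Fin 5) ℝ g) (a b : ℝ) : Prop :=
  d (e E 1) = 0 ∧
  d (e E 2) = 0 ∧
  d (e E 3) = a • ee E 1 3 + b • ee E 1 4 - b • ee E 2 3 + a • ee E 2 4
    - (a ^ 2 + b ^ 2) • ee E 2 5 ∧
  d (e E 4) = b • ee E 1 3 - a • ee E 1 4 - (a ^ 2 + b ^ 2) • ee E 1 5 + a • ee E 2 3
    + b • ee E 2 4 ∧
  d (e E 5) = (-2 : ℝ) • ee E 1 4 - (2 : ℝ) • ee E 2 3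

def Family5 (E : Basis (Fin 5) ℝ g) (r : ℝ) : Prop :=
  d (e E 1) = 0 ∧
  d (e E 2) = r • ee E 3 4 + (r ^ 2 / 2) • ee E 3 5 ∧
  d (e E 3) = r • ee E 1 3 ∧
  d (e E 4) = -(r ^ 2 / 2) • ee E 1 5 + r • ee E 2 3 ∧
  d (e E 5) = (-2 : ℝ) • ee E 1 4 - (2 : ℝ) • ee E 2 3

def Family6 (E : Basis (Fin 5) ℝ g) (r a : ℝ) : Prop :=
  d (e E 1) = 0 ∧
  d (e E 2) = r • ee E 1 2 + a • ee E 1 3 + a • ee E 2 4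
    + (a / (2 * r) * (r ^ 2 + a ^ 2)) • ee E 2 5 + (a ^ 2 / r) • ee E 3 4
    + (a ^ 2 / (2 * r ^ 2) * (r ^ 2 + a ^ 2)) • ee E 3 5 ∧
  d (e E 3) = a • ee E 1 2 + (a ^ 2 / r) • ee E 1 3 - r • ee E 2 4
    - (1 / 2 * (r ^ 2 + a ^ 2)) • ee E 2 5 - a • ee E 3 4
    - (a / (2 * r) * (r ^ 2 + a ^ 2)) • ee E 3 5 ∧
  d (e E 4) = -((r ^ 2 + a ^ 2) ^ 2 / (2 * r ^ 2)) • ee E 1 5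
    + ((r ^ 2 + a ^ 2) / r) • ee E 2 3 ∧
  d (e E 5) = (-2 : ℝ) • ee E 1 4 - (2 : ℝ) • ee E 2 3

end Bases

/-- The term `g^k` of the derived series (`g⁰ = g`, `g^{k+1} = [g^k, g^k]`), as a subspace. -/
def derived (g : Type*) [LieRing g] [LieAlgebra ℝ g] (k : ℕ) : Submodule ℝ g :=
  (LieAlgebra.derivedSeries ℝ g k).toSubmodule

end HypoContact

/-!
In all six families `e¹` is closed, so the first aim is an adapted basis with this property. Any
two adapted bases differ by a unit quaternion (`rotate`), and if `e¹` is closed then the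
conditions of a hypo-contact structure, which are linear in the structure constants, give back the
general equations with `A = 0` (`IsHypoContact.structureEquations`). If `A ≠ 0`, the Jacobi
identity makes `de¹` and `de⁴` multiples of the same form `ω₃`, so a rotation in the plane of `e¹`
and `e⁴` makes the first form closed (`GeneralEquations.exists_closed`).

For `A = 0` the Jacobi identity expresses all coefficients by six of them, here called `p, b, m,
s, q, c` (`ReducedEquations`), and leaves cubic relations between these (`ReducedRelations`). The
case distinction is on `p + s`.

If `p + s ≠ 0`, the relations give families 1 and 2 or a branch whose Lie algebras have a
3-dimensional perfect subquotient unless `s = q`, which solvability excludes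
(`not_perfect_subquotient`); the part `s = q` consists of families 5 and 6.

If `p + s = 0`, then `b² = p q`. For `p = 0` or `p + q = 0` the equations are those of family 3 or
4. Otherwise there is a plane of closed forms spanned by `e¹` and a combination of `e²` and `e³`.
Taking as new `e¹` the unit vector at angle `θ` in this plane changes `p + q` to `t cos 3θ - k sin
3θ` for some `t` and `k` (`ReducedEquations.rotate`), so some `θ` makes it zero, and the new basis
is covered by a case already treated.

The derived series of each family is computed from explicit brackets.
-/

namespace HypoContact

open Module

variable {g : Type*} [LieRing g] [LieAlgebra ℝ g]

/-! ### Coordinates and the Jacobi identity -/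

theorem d_apply (α : Dual ℝ g) (x y : g) : d α x y = -α ⁅x, y⁆ := rfl

theorem ee_apply (E : Basis (Fin 5) ℝ g) (i j : Fin 5) (x y : g) :
    ee E i j x y = e E i x * e E j y - e E j x * e E i y := by
  simp only [ee, wedge, LinearMap.mk₂_apply]
  ring

theorem e_bracket (E : Basis (Fin 5) ℝ g) (k : Fin 5) (x y : g) :
    e E k ⁅x, y⁆ = -(d (e E k) x y) := by
  simp [d_apply]

theorem e_basis (E : Basis (Fin 5) ℝ g) (i j : Fin 5) : e E i (E j) = if j = i then 1 else 0 := by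
  simp [e, Finsupp.single_apply]

/-- The Jacobi identity, in the form `d (dα) = 0`. -/
theorem d_d (α : Dual ℝ g) (x y z : g) :
    d α ⁅x, y⁆ z - d α ⁅x, z⁆ y + d α ⁅y, z⁆ x = 0 := by
  have h : ⁅⁅x, y⁆, z⁆ - ⁅⁅x, z⁆, y⁆ + ⁅⁅y, z⁆, x⁆ = 0 := by
    rw [← lie_skew ⁅x, y⁆ z, ← lie_skew ⁅x, z⁆ y, ← lie_skew ⁅y, z⁆ x, leibniz_lie x y z,
      ← lie_skew z ⁅x, y⁆]
    abel
  have h' := congrArg α h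
  rw [map_add, map_sub, map_zero] at h'
  simp only [d_apply]
  linear_combination -h'

/-- The simplifier reads the index `5` as `0`, so coordinate computations are done with `E 0`. -/
theorem five_eq_zero : (5 : Fin 5) = 0 := rfl

/-- An element is determined by its five coordinates. -/
theorem ext_coord (E : Basis (Fin 5) ℝ g) {x y : g} (h1 : e E 1 x = e E 1 y)
    (h2 : e E 2 x = e E 2 y) (h3 : e E 3 x = e E 3 y) (h4 : e E 4 x = e E 4 y)
    (h5 : e E 5 x = e E 5 y) : x = y := by
  refine E.ext_elem fun i => ?_
  fin_cases i
  exacts [h5, h1, h2, h3, h4]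

/-- The equations of `GeneralEquations` for given values of the coefficients. -/
def StructureEquations (E : Basis (Fin 5) ℝ g)
    (A B₁₂ B₁₃ B₁₄ B₁₅ B₂₅ B₃₄ B₃₅ C₁₃ C₁₄ C₁₅ C₂₅ D₁₅ : ℝ) : Prop :=
  d (e E 1) = A • ee E 1 4 + A • ee E 2 3 ∧
    d (e E 2) = B₁₂ • ee E 1 2 + B₁₃ • ee E 1 3 + B₁₄ • ee E 1 4 + B₁₅ • ee E 1 5
      - B₁₄ • ee E 2 3 + (2 * A + B₁₃) • ee E 2 4 + B₂₅ • ee E 2 5 + B₃₄ • ee E 3 4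
      + B₃₅ • ee E 3 5 ∧
    d (e E 3) = (3 * A + B₁₃) • ee E 1 2 + C₁₃ • ee E 1 3 + C₁₄ • ee E 1 4 + C₁₅ • ee E 1 5
      - C₁₄ • ee E 2 3 - (B₁₂ + B₃₄ - C₁₃) • ee E 2 4 + C₂₅ • ee E 2 5
      - (A + B₁₃) • ee E 3 4 - B₂₅ • ee E 3 5 ∧
    d (e E 4) = B₁₄ • ee E 1 2 + C₁₄ • ee E 1 3 + (B₃₄ - C₁₃) • ee E 1 4 + D₁₅ • ee E 1 5
      + (B₁₂ + C₁₃) • ee E 2 3 + C₁₄ • ee E 2 4 + C₁₅ • ee E 2 5 - B₁₄ • ee E 3 4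
      - B₁₅ • ee E 3 5 ∧
    d (e E 5) = (-2 : ℝ) • ee E 1 4 - (2 : ℝ) • ee E 2 3

/-- The quadratic equations for the coefficients that follow from the Jacobi identity: the field
`dk_ijl` is the vanishing of `d (deᵏ)` on `(Eᵢ, Eⱼ, Eₗ)`, up to sign. Only the components used in
the classification are listed. -/
structure JacobiRelations (A B₁₂ B₁₃ B₁₄ B₁₅ B₂₅ B₃₄ B₃₅ C₁₃ C₁₄ C₁₅ C₂₅ D₁₅ : ℝ) : Prop where
  d2_123 : 2 * A * C₁₄ - B₁₂ * B₁₄ + 2 * B₁₃ * C₁₄ - B₁₄ * B₃₄ - 2 * B₁₄ * C₁₃ + 2 * B₁₅ = 0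
  d2_124 : -A * B₁₂ + 5 * A * B₃₄ - 2 * A * C₁₃ + B₁₂ * B₁₃ + 3 * B₁₃ * B₃₄ - 2 * B₁₃ * C₁₃
    - 2 * B₁₄ * C₁₄ - 2 * B₂₅ = 0
  d2_134 : 2 * A * B₁₃ - B₁₂ * B₃₄ + 2 * B₁₃ ^ 2 + 2 * B₁₄ ^ 2 + B₃₄ ^ 2 - 2 * B₃₅ = 0
  d3_123 : 4 * A * B₁₄ - 3 * B₁₂ * C₁₄ + 2 * B₁₃ * B₁₄ - B₃₄ * C₁₄ + 2 * C₁₅ = 0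
  d3_124 : -10 * A * B₁₃ - 12 * A ^ 2 - 2 * B₁₂ * B₃₄ + 3 * B₁₂ * C₁₃ - B₁₂ ^ 2 - 2 * B₁₃ ^ 2
    + 3 * B₃₄ * C₁₃ - B₃₄ ^ 2 - 2 * C₁₃ ^ 2 - 2 * C₁₄ ^ 2 - 2 * C₂₅ = 0
  d4_123 : -B₁₂ * B₃₄ + 3 * B₁₂ * C₁₃ + B₁₂ ^ 2 + 2 * B₁₄ ^ 2 - B₃₄ * C₁₃ + 2 * C₁₃ ^ 2
    + 2 * C₁₄ ^ 2 + 2 * D₁₅ = 0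
  d2_234 : 2 * A * B₁₄ = 0
  d3_234 : 2 * A * C₁₄ = 0
  d4_234 : -A * B₁₂ + A * B₃₄ - 2 * A * C₁₃ = 0
  d2_125 : 3 * A * B₃₅ + 2 * A * D₁₅ + B₁₃ * B₃₅ - B₁₃ * C₂₅ + B₁₃ * D₁₅ - 2 * B₁₄ * C₁₅ = 0
  d2_135 : -B₁₂ * B₃₅ + 2 * B₁₃ * B₂₅ + 2 * B₁₄ * B₁₅ + B₃₄ * D₁₅ + B₃₅ * C₁₃ = 0
  d2_145 : -A * B₁₅ - B₁₃ * B₁₅ + B₁₄ * B₂₅ - B₃₄ * C₁₅ + B₃₅ * C₁₄ = 0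
  d2_245 : -B₁₂ * B₃₅ - B₃₄ * B₃₅ - B₃₄ * C₂₅ + B₃₅ * C₁₃ = 0
  d2_345 : -3 * A * B₃₅ - 2 * B₁₃ * B₃₅ + 2 * B₂₅ * B₃₄ = 0
  d3_125 : -6 * A * B₂₅ + B₁₂ * C₂₅ - B₁₂ * D₁₅ - 2 * B₁₃ * B₂₅ - B₃₄ * D₁₅ - C₁₃ * C₂₅
    + C₁₃ * D₁₅ - 2 * C₁₄ * C₁₅ = 0
  d3_145 : 2 * A * C₁₅ + B₁₂ * B₁₅ + B₁₃ * C₁₅ + B₁₄ * C₂₅ + B₁₅ * B₃₄ - B₁₅ * C₁₃ - B₂₅ * C₁₄ = 0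
  d4_125 : -3 * A * B₁₅ + 2 * B₁₂ * C₁₅ - B₁₃ * B₁₅ - B₁₄ * B₂₅ - B₃₄ * C₁₅ + 2 * C₁₃ * C₁₅
    - C₁₄ * C₂₅ + C₁₄ * D₁₅ = 0
  d4_135 : -B₁₂ * B₁₅ + B₁₃ * C₁₅ - B₁₄ * B₃₅ - B₁₄ * D₁₅ + B₁₅ * B₃₄ - 3 * B₁₅ * C₁₃
    + B₂₅ * C₁₄ = 0
  d4_145 : A * D₁₅ + 2 * B₁₄ * C₁₅ - 2 * B₁₅ * C₁₄ = 0

set_option maxHeartbeats 2000000 in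
theorem StructureEquations.jacobi {E : Basis (Fin 5) ℝ g}
    {A B₁₂ B₁₃ B₁₄ B₁₅ B₂₅ B₃₄ B₃₅ C₁₃ C₁₄ C₁₅ C₂₅ D₁₅ : ℝ}
    (h : StructureEquations E A B₁₂ B₁₃ B₁₄ B₁₅ B₂₅ B₃₄ B₃₅ C₁₃ C₁₄ C₁₅ C₂₅ D₁₅) :
    JacobiRelations A B₁₂ B₁₃ B₁₄ B₁₅ B₂₅ B₃₄ B₃₅ C₁₃ C₁₄ C₁₅ C₂₅ D₁₅ := by
  obtain ⟨h1, h2, h3, h4, h5⟩ := h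
  rw [five_eq_zero] at h5
  have h1 (x y) := LinearMap.congr_fun₂ h1 x y
  have h2 (x y) := LinearMap.congr_fun₂ h2 x y
  have h3 (x y) := LinearMap.congr_fun₂ h3 x y
  have h4 (x y) := LinearMap.congr_fun₂ h4 x y
  have h5 (x y) := LinearMap.congr_fun₂ h5 x y
  simp only [five_eq_zero, LinearMap.add_apply, LinearMap.sub_apply, LinearMap.smul_apply,
    smul_eq_mul, ee_apply] at h1 h2 h3 h4 h5
  constructor
  case' d2_123 => have := d_d (e E 2) (E 1) (E 2) (E 3)
  case' d2_124 => have := d_d (e E 2) (E 1) (E 2) (E 4)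
  case' d2_134 => have := d_d (e E 2) (E 1) (E 3) (E 4)
  case' d3_123 => have := d_d (e E 3) (E 1) (E 2) (E 3)
  case' d3_124 => have := d_d (e E 3) (E 1) (E 2) (E 4)
  case' d4_123 => have := d_d (e E 4) (E 1) (E 2) (E 3)
  case' d2_234 => have := d_d (e E 2) (E 2) (E 3) (E 4)
  case' d3_234 => have := d_d (e E 3) (E 2) (E 3) (E 4)
  case' d4_234 => have := d_d (e E 4) (E 2) (E 3) (E 4)
  case' d2_125 => have := d_d (e E 2) (E 1) (E 2) (E 0)
  case' d2_135 => have := d_d (e E 2) (E 1) (E 3) (E 0)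
  case' d2_145 => have := d_d (e E 2) (E 1) (E 4) (E 0)
  case' d2_245 => have := d_d (e E 2) (E 2) (E 4) (E 0)
  case' d2_345 => have := d_d (e E 2) (E 3) (E 4) (E 0)
  case' d3_125 => have := d_d (e E 3) (E 1) (E 2) (E 0)
  case' d3_145 => have := d_d (e E 3) (E 1) (E 4) (E 0)
  case' d4_125 => have := d_d (e E 4) (E 1) (E 2) (E 0)
  case' d4_135 => have := d_d (e E 4) (E 1) (E 3) (E 0)
  case' d4_145 => have := d_d (e E 4) (E 1) (E 4) (E 0)
  all_goals
    simp [e_bracket, h1, h2, h3, h4, h5, e_basis] at this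
    linear_combination -this

/-! ### Adapted bases -/

/-- The basis obtained from `E` by a unit quaternion `(x, y, z, w)`. The new `e¹` is `x e¹ + y e²
+ z e³ + w e⁴`, and the new `e²`, `e³`, `e⁴` are its images under the complex structures
determined by `ω₁`, `ω₂`, `ω₃`; `e⁵` is unchanged. In the formulas for coordinate vectors below,
index `0` stands for `5`. -/
noncomputable def rotate (E : Basis (Fin 5) ℝ g) {x y z w : ℝ}
    (h : x ^ 2 + y ^ 2 + z ^ 2 + w ^ 2 = 1) : Basis (Fin 5) ℝ g :=
  Basis.ofEquivFun
    { toFun := fun v => ![e E 5 v,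
        x * e E 1 v + y * e E 2 v + z * e E 3 v + w * e E 4 v,
        -y * e E 1 v + x * e E 2 v - w * e E 3 v + z * e E 4 v,
        -z * e E 1 v + w * e E 2 v + x * e E 3 v - y * e E 4 v,
        -w * e E 1 v - z * e E 2 v + y * e E 3 v + x * e E 4 v]
      invFun := fun c => c 0 • E 5
        + c 1 • (x • E 1 + y • E 2 + z • E 3 + w • E 4)
        + c 2 • (-y • E 1 + x • E 2 - w • E 3 + z • E 4)
        + c 3 • (-z • E 1 + w • E 2 + x • E 3 - y • E 4)
        + c 4 • (-w • E 1 - z • E 2 + y • E 3 + x • E 4)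
      map_add' := by
        intro u v
        ext i
        fin_cases i <;> simp <;> ring
      map_smul' := by
        intro c v
        ext i
        fin_cases i <;> simp <;> ring
      left_inv := by
        intro v
        refine ext_coord E ?_ ?_ ?_ ?_ ?_ <;> simp [e_basis]
        · linear_combination e E 1 v * h
        · linear_combination e E 2 v * h
        · linear_combination e E 3 v * h
        · linear_combination e E 4 v * h
      right_inv := by
        intro c
        ext i
        fin_cases i <;> simp [e_basis]
        · linear_combination c 1 * h
        · linear_combination c 2 * h
        · linear_combination c 3 * h
        · linear_combination c 4 * h }

section rotate

variable (E : Basis (Fin 5) ℝ g) {x y z w : ℝ} (h : x ^ 2 + y ^ 2 + z ^ 2 + w ^ 2 = 1)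

theorem e_rotate_one :
    e (rotate E h) 1 = x • e E 1 + y • e E 2 + z • e E 3 + w • e E 4 := by
  ext v
  simp [e, rotate]

theorem e_rotate_two :
    e (rotate E h) 2 = -y • e E 1 + x • e E 2 - w • e E 3 + z • e E 4 := by
  ext v
  simp [e, rotate]

theorem e_rotate_three :
    e (rotate E h) 3 = -z • e E 1 + w • e E 2 + x • e E 3 - y • e E 4 := by
  ext v
  simp [e, rotate]

theorem e_rotate_four :
    e (rotate E h) 4 = -w • e E 1 - z • e E 2 + y • e E 3 + x • e E 4 := by
  ext v
  simp [e, rotate]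

theorem e_rotate_five : e (rotate E h) 5 = e E 5 := by
  ext v
  simp [e, rotate]

theorem rotate_two : rotate E h 2 = -y • E 1 + x • E 2 - w • E 3 + z • E 4 := by
  simp [rotate, Fin.ext_iff]

theorem rotate_three : rotate E h 3 = -z • E 1 + w • E 2 + x • E 3 - y • E 4 := by
  simp [rotate, Fin.ext_iff]

variable {E}

theorem IsAdapted.rotate {η : Dual ℝ g} {ω₁ ω₂ ω₃ : LinearMap.BilinForm ℝ g}
    (hE : IsAdapted E η ω₁ ω₂ ω₃) : IsAdapted (rotate E h) η ω₁ ω₂ ω₃ where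
  eta := by rw [hE.eta, e_rotate_five]
  omega₁ := by
    rw [hE.omega₁]
    ext u v
    simp only [LinearMap.add_apply, LinearMap.sub_apply, LinearMap.smul_apply, smul_eq_mul,
      ee_apply, e_rotate_one, e_rotate_two, e_rotate_three, e_rotate_four]
    linear_combination -(e E 1 u * e E 2 v - e E 2 u * e E 1 v + e E 3 u * e E 4 v
      - e E 4 u * e E 3 v) * h
  omega₂ := by
    rw [hE.omega₂]
    ext u v
    simp only [LinearMap.add_apply, LinearMap.sub_apply, LinearMap.smul_apply, smul_eq_mul,
      ee_apply, e_rotate_one, e_rotate_two, e_rotate_three, e_rotate_four]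
    linear_combination -(e E 1 u * e E 3 v - e E 3 u * e E 1 v + e E 4 u * e E 2 v
      - e E 2 u * e E 4 v) * h
  omega₃ := by
    rw [hE.omega₃]
    ext u v
    simp only [LinearMap.add_apply, LinearMap.sub_apply, LinearMap.smul_apply, smul_eq_mul,
      ee_apply, e_rotate_one, e_rotate_two, e_rotate_three, e_rotate_four]
    linear_combination -(e E 1 u * e E 4 v - e E 4 u * e E 1 v + e E 2 u * e E 3 v
      - e E 3 u * e E 2 v) * h

end rotate

/-- The expansion of `dα` in the basis `eⁱʲ`, `i < j`, of 2-forms. -/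
theorem d_eq_sum (E : Basis (Fin 5) ℝ g) (α : Dual ℝ g) :
    d α = d α (E 1) (E 2) • ee E 1 2 + d α (E 1) (E 3) • ee E 1 3 + d α (E 1) (E 4) • ee E 1 4
      + d α (E 1) (E 5) • ee E 1 5 + d α (E 2) (E 3) • ee E 2 3 + d α (E 2) (E 4) • ee E 2 4
      + d α (E 2) (E 5) • ee E 2 5 + d α (E 3) (E 4) • ee E 3 4 + d α (E 3) (E 5) • ee E 3 5
      + d α (E 4) (E 5) • ee E 4 5 := by
  have hs (x y : g) : d α x y = -d α y x := by
    rw [d_apply, d_apply, ← lie_skew, map_neg]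
  have h0 (x : g) : d α x x = 0 := by simp [d_apply]
  refine LinearMap.ext_basis E E fun i j => ?_
  fin_cases i <;> fin_cases j <;> simp [ee_apply, e_basis, h0] <;> exact hs _ _

set_option maxHeartbeats 1000000 in
/-- If `e¹` is closed, then the general equations hold with `A = 0`. Indeed `d (dη) = 0`, `d (η ∧
ω₁) = 0` and `d (η ∧ ω₂) = 0` are linear in the coefficients of `de²`, `de³`, `de⁴`, and these
general equations are their solution. Hence a new adapted basis needs only its first form to be
closed, and no transformation rule for the coefficients is needed. -/
theorem IsHypoContact.structureEquations {η : Dual ℝ g} {ω₁ ω₂ ω₃ : LinearMap.BilinForm ℝ g}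
    (hη : IsHypoContact η ω₁ ω₂ ω₃) {E : Basis (Fin 5) ℝ g} (hE : IsAdapted E η ω₁ ω₂ ω₃)
    (h1 : d (e E 1) = 0) :
    ∃ B₁₂ B₁₃ B₁₄ B₁₅ B₂₅ B₃₄ B₃₅ C₁₃ C₁₄ C₁₅ C₂₅ D₁₅ : ℝ,
      StructureEquations E 0 B₁₂ B₁₃ B₁₄ B₁₅ B₂₅ B₃₄ B₃₅ C₁₃ C₁₄ C₁₅ C₂₅ D₁₅ := by
  have h5 : d (e E 5) = (-2 : ℝ) • ee E 1 4 - (2 : ℝ) • ee E 2 3 := by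
    rw [← hE.eta, hη.d_eta, hE.omega₃]
    module
  have h5' (u v) := LinearMap.congr_fun₂ h5 u v
  simp only [five_eq_zero, LinearMap.sub_apply, LinearMap.smul_apply, smul_eq_mul, ee_apply] at h5'
  -- `d (dη) = 0`, on the triples of basis vectors
  have t (i j k : Fin 5) := d_d (e E 0) (E i) (E j) (E k)
  -- `d (η ∧ ω₁) = 0` and `d (η ∧ ω₂) = 0`, on the quadruples with last entry `E 5`
  have t₁ (i j k : Fin 5) : d₃ (wedge₁₂ η ω₁) (E i) (E j) (E k) (E 0) = 0 := by
    rw [hη.d_eta_wedge₁]; rfl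
  have t₂ (i j k : Fin 5) : d₃ (wedge₁₂ η ω₂) (E i) (E j) (E k) (E 0) = 0 := by
    rw [hη.d_eta_wedge₂]; rfl
  have p1 := t 1 2 3
  have p2 := t 1 2 4
  have p3 := t 1 3 4
  have p4 := t 2 3 4
  have p5 := t 1 2 0
  have p6 := t 1 3 0
  have p7 := t 1 4 0
  have p8 := t 2 3 0
  have p9 := t 2 4 0
  have p10 := t 3 4 0
  have q1 := t₁ 1 2 3
  have q2 := t₁ 1 2 4
  have q3 := t₁ 1 3 4
  have q4 := t₁ 2 3 4
  have r1 := t₂ 1 2 3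
  have r2 := t₂ 1 2 4
  have r3 := t₂ 1 3 4
  have r4 := t₂ 2 3 4
  simp [h5', e_basis, e_bracket, h1] at p1 p2 p3 p4 p5 p6 p7 p8 p9 p10
  simp [d₃, wedge₁₂, hE.eta, hE.omega₁, hE.omega₂, five_eq_zero, h5', ee_apply,
    e_basis, e_bracket, h1] at q1 q2 q3 q4 r1 r2 r3 r4
  have c2_23 : d (e E 2) (E 2) (E 3) = -d (e E 2) (E 1) (E 4) := by
    linarith only [p3, r4]
  have c2_24 : d (e E 2) (E 2) (E 4) = d (e E 2) (E 1) (E 3) := by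
    linarith only [p4, r3]
  have c2_40 : d (e E 2) (E 4) (E 0) = 0 := by
    linarith only [p10]
  have c3_12 : d (e E 3) (E 1) (E 2) = d (e E 2) (E 1) (E 3) := by
    linarith only [q2, p4, r3]
  have c3_23 : d (e E 3) (E 2) (E 3) = -d (e E 3) (E 1) (E 4) := by
    linarith only [q4, p2]
  have c3_24 : d (e E 3) (E 2) (E 4) =
      -(d (e E 2) (E 1) (E 2) + d (e E 2) (E 3) (E 4) - d (e E 3) (E 1) (E 3)) := by
    linarith only [r2, q3]
  have c3_34 : d (e E 3) (E 3) (E 4) = -d (e E 2) (E 1) (E 3) := by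
    linarith only [r3]
  have c3_30 : d (e E 3) (E 3) (E 0) = -d (e E 2) (E 2) (E 0) := by
    linarith only [p8]
  have c3_40 : d (e E 3) (E 4) (E 0) = 0 := by
    linarith only [p9]
  have c4_12 : d (e E 4) (E 1) (E 2) = d (e E 2) (E 1) (E 4) := by
    linarith only [q1, p3, r4]
  have c4_13 : d (e E 4) (E 1) (E 3) = d (e E 3) (E 1) (E 4) := by
    linarith only [r1, q4, p2]
  have c4_14 : d (e E 4) (E 1) (E 4) = d (e E 2) (E 3) (E 4) - d (e E 3) (E 1) (E 3) := by
    linarith only [q3]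
  have c4_23 : d (e E 4) (E 2) (E 3) = d (e E 2) (E 1) (E 2) + d (e E 3) (E 1) (E 3) := by
    linarith only [p1]
  have c4_24 : d (e E 4) (E 2) (E 4) = d (e E 3) (E 1) (E 4) := by
    linarith only [p2]
  have c4_20 : d (e E 4) (E 2) (E 0) = d (e E 3) (E 1) (E 0) := by
    linarith only [p5]
  have c4_34 : d (e E 4) (E 3) (E 4) = -d (e E 2) (E 1) (E 4) := by
    linarith only [p3]
  have c4_30 : d (e E 4) (E 3) (E 0) = -d (e E 2) (E 1) (E 0) := by
    linarith only [p6]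
  have c4_40 : d (e E 4) (E 4) (E 0) = 0 := by
    linarith only [p7]
  refine ⟨d (e E 2) (E 1) (E 2), d (e E 2) (E 1) (E 3), d (e E 2) (E 1) (E 4),
    d (e E 2) (E 1) (E 0), d (e E 2) (E 2) (E 0), d (e E 2) (E 3) (E 4), d (e E 2) (E 3) (E 0),
    d (e E 3) (E 1) (E 3), d (e E 3) (E 1) (E 4), d (e E 3) (E 1) (E 0), d (e E 3) (E 2) (E 0),
    d (e E 4) (E 1) (E 0), ?_, ?_, ?_, ?_, h5⟩
  · rw [h1]
    module
  · refine (d_eq_sum E (e E 2)).trans ?_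
    simp only [five_eq_zero, c2_23, c2_24, c2_40]
    module
  · refine (d_eq_sum E (e E 3)).trans ?_
    simp only [five_eq_zero, c3_12, c3_23, c3_24, c3_34, c3_30, c3_40]
    module
  · refine (d_eq_sum E (e E 4)).trans ?_
    simp only [five_eq_zero, c4_12, c4_13, c4_14, c4_23, c4_24, c4_20, c4_34, c4_30, c4_40]
    module

/-! ### The derived series and solvability -/

theorem mem_derived_succ {k : ℕ} {x y : g} (hx : x ∈ derived g k) (hy : y ∈ derived g k) :
    ⁅x, y⁆ ∈ derived g (k + 1) := by
  simp only [derived, LieSubmodule.mem_toSubmodule, LieAlgebra.derivedSeriesOfIdeal_succ] at hx hy ⊢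
  exact LieSubmodule.lie_mem_lie hx hy

theorem derived_succ_le {k : ℕ} {S : Submodule ℝ g}
    (h : ∀ x ∈ derived g k, ∀ y ∈ derived g k, ⁅x, y⁆ ∈ S) : derived g (k + 1) ≤ S := by
  simp only [derived, LieAlgebra.derivedSeriesOfIdeal_succ]
  rw [LieSubmodule.lieIdeal_oper_eq_linear_span', Submodule.span_le]
  rintro _ ⟨x, hx, y, hy, rfl⟩
  exact h x hx y hy

theorem mem_derived_zero (x : g) : x ∈ derived g 0 := by
  simp [derived]

theorem exists_derived_eq_bot [LieAlgebra.IsSolvable g] : ∃ k, derived g k = ⊥ := by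
  obtain ⟨k, hk⟩ := LieAlgebra.IsSolvable.solvable ℝ g
  exact ⟨k, by simp [derived, hk]⟩

/-- A solvable Lie algebra has no three-dimensional perfect subquotient. Here the subquotient is the
image of the kernel of `α` under `(β₁, β₂, β₃)`, and the columns of `a` are the brackets of its
basis vectors. -/
theorem not_perfect_subquotient [LieAlgebra.IsSolvable g] (α β₁ β₂ β₃ : Dual ℝ g)
    {x₁ x₂ x₃ : g} (hx₁ : α x₁ = 0 ∧ β₁ x₁ = 1 ∧ β₂ x₁ = 0 ∧ β₃ x₁ = 0)
    (hx₂ : α x₂ = 0 ∧ β₁ x₂ = 0 ∧ β₂ x₂ = 1 ∧ β₃ x₂ = 0)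
    (hx₃ : α x₃ = 0 ∧ β₁ x₃ = 0 ∧ β₂ x₃ = 0 ∧ β₃ x₃ = 1)
    (a : Matrix (Fin 3) (Fin 3) ℝ) (ha : a.det ≠ 0)
    (hα : ∀ x y : g, α ⁅x, y⁆ = 0)
    (hβ₁ : ∀ x y, α x = 0 → α y = 0 → β₁ ⁅x, y⁆ = a 0 0 * (β₁ x * β₂ y - β₂ x * β₁ y)
      + a 0 1 * (β₁ x * β₃ y - β₃ x * β₁ y) + a 0 2 * (β₂ x * β₃ y - β₃ x * β₂ y))
    (hβ₂ : ∀ x y, α x = 0 → α y = 0 → β₂ ⁅x, y⁆ = a 1 0 * (β₁ x * β₂ y - β₂ x * β₁ y)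
      + a 1 1 * (β₁ x * β₃ y - β₃ x * β₁ y) + a 1 2 * (β₂ x * β₃ y - β₃ x * β₂ y))
    (hβ₃ : ∀ x y, α x = 0 → α y = 0 → β₃ ⁅x, y⁆ = a 2 0 * (β₁ x * β₂ y - β₂ x * β₁ y)
      + a 2 1 * (β₁ x * β₃ y - β₃ x * β₁ y) + a 2 2 * (β₂ x * β₃ y - β₃ x * β₂ y)) :
    False := by
  have key : ∀ k : ℕ, ∀ v : Fin 3 → ℝ, ∃ x ∈ derived g k,
      α x = 0 ∧ β₁ x = v 0 ∧ β₂ x = v 1 ∧ β₃ x = v 2 := by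
    intro k
    induction k with
    | zero =>
      intro v
      refine ⟨v 0 • x₁ + v 1 • x₂ + v 2 • x₃, mem_derived_zero _, ?_⟩
      simp [hx₁, hx₂, hx₃]
    | succ k ih =>
      intro v
      obtain ⟨y₁, hy₁, h10, h11, h12, h13⟩ := ih ![1, 0, 0]
      obtain ⟨y₂, hy₂, h20, h21, h22, h23⟩ := ih ![0, 1, 0]
      obtain ⟨y₃, hy₃, h30, h31, h32, h33⟩ := ih ![0, 0, 1]
      -- the coefficients of a combination of brackets with coordinates `v`
      set u := a⁻¹.mulVec v with hu
      have hau : a.mulVec u = v := by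
        rw [hu, Matrix.mulVec_mulVec, Matrix.mul_nonsing_inv _ (isUnit_iff_ne_zero.2 ha),
          Matrix.one_mulVec]
      have hv (i : Fin 3) : a i 0 * u 0 + a i 1 * u 1 + a i 2 * u 2 = v i := by
        rw [← hau]
        simp [Matrix.mulVec, dotProduct, Fin.sum_univ_three]
      refine ⟨u 0 • ⁅y₁, y₂⁆ + u 1 • ⁅y₁, y₃⁆ + u 2 • ⁅y₂, y₃⁆,
        add_mem (add_mem ?_ ?_) ?_, ?_, ?_, ?_, ?_⟩
      · exact Submodule.smul_mem _ _ (mem_derived_succ hy₁ hy₂)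
      · exact Submodule.smul_mem _ _ (mem_derived_succ hy₁ hy₃)
      · exact Submodule.smul_mem _ _ (mem_derived_succ hy₂ hy₃)
      · simp [hα]
      · simp [hβ₁, h10, h11, h12, h13, h20, h21, h22, h23, h30, h31, h32, h33, ← hv]; ring
      · simp [hβ₂, h10, h11, h12, h13, h20, h21, h22, h23, h30, h31, h32, h33, ← hv]; ring
      · simp [hβ₃, h10, h11, h12, h13, h20, h21, h22, h23, h30, h31, h32, h33, ← hv]; ring
  obtain ⟨k, hk⟩ := exists_derived_eq_bot (g := g)
  obtain ⟨x, hx, -, h1, -⟩ := key k ![1, 0, 0]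
  rw [hk, Submodule.mem_bot] at hx
  simp [hx] at h1

theorem lie_mem_derived_one (x y : g) : ⁅x, y⁆ ∈ derived g 1 :=
  mem_derived_succ (mem_derived_zero x) (mem_derived_zero y)

theorem derived_one_le {S : Submodule ℝ g} (h : ∀ x y : g, ⁅x, y⁆ ∈ S) : derived g 1 ≤ S :=
  derived_succ_le fun x _ y _ => h x y

theorem derived_succ_eq_bot {k : ℕ} {S : Set g} (hS : derived g k = Submodule.span ℝ S)
    (h : ∀ u ∈ S, ∀ v ∈ S, ⁅u, v⁆ = 0) : derived g (k + 1) = ⊥ := by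
  refine eq_bot_iff.2 (derived_succ_le fun x hx y hy => ?_)
  rw [hS] at hx hy
  rw [Submodule.mem_bot]
  induction hx using Submodule.span_induction with
  | mem u hu =>
    induction hy using Submodule.span_induction with
    | mem v hv => exact h u hu v hv
    | zero => simp
    | add v w _ _ hv hw => rw [lie_add, hv, hw, add_zero]
    | smul c v _ hv => rw [lie_smul, hv, smul_zero]
  | zero => simp
  | add v w _ _ hv hw => rw [add_lie, hv, hw, add_zero]
  | smul c v _ hv => rw [smul_lie, hv, smul_zero]

theorem derived_succ_eq_bot_of_singleton {k : ℕ} {u : g} (hS : derived g k = Submodule.span ℝ {u}) :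
    derived g (k + 1) = ⊥ :=
  derived_succ_eq_bot hS (by simp)

theorem derived_succ_eq_bot_of_pair {k : ℕ} {u v : g} (hS : derived g k = Submodule.span ℝ {u, v})
    (h : ⁅u, v⁆ = 0) : derived g (k + 1) = ⊥ := by
  have h' : ⁅v, u⁆ = 0 := by rw [← lie_skew, h, neg_zero]
  exact derived_succ_eq_bot hS (by simp [h, h'])

theorem derived_succ_eq_bot_of_triple {k : ℕ} {u v w : g}
    (hS : derived g k = Submodule.span ℝ {u, v, w}) (huv : ⁅u, v⁆ = 0) (huw : ⁅u, w⁆ = 0)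
    (hvw : ⁅v, w⁆ = 0) : derived g (k + 1) = ⊥ := by
  have huv' : ⁅v, u⁆ = 0 := by rw [← lie_skew, huv, neg_zero]
  have huw' : ⁅w, u⁆ = 0 := by rw [← lie_skew, huw, neg_zero]
  have hvw' : ⁅w, v⁆ = 0 := by rw [← lie_skew, hvw, neg_zero]
  exact derived_succ_eq_bot hS (by simp [huv, huw, hvw, huv', huw', hvw'])

theorem span_le_of_four {S : Submodule ℝ g} {x y z w : g} (hx : x ∈ S) (hy : y ∈ S) (hz : z ∈ S)
    (hw : w ∈ S) : Submodule.span ℝ {x, y, z, w} ≤ S := by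
  rw [Submodule.span_le]
  rintro v (rfl | rfl | rfl | rfl)
  exacts [hx, hy, hz, hw]

theorem span_le_of_three {S : Submodule ℝ g} {x y z : g} (hx : x ∈ S) (hy : y ∈ S) (hz : z ∈ S) :
    Submodule.span ℝ {x, y, z} ≤ S := by
  rw [Submodule.span_le]
  rintro v (rfl | rfl | rfl)
  exacts [hx, hy, hz]

theorem span_le_of_two {S : Submodule ℝ g} {x y : g} (hx : x ∈ S) (hy : y ∈ S) :
    Submodule.span ℝ {x, y} ≤ S := by
  rw [Submodule.span_le]
  rintro v (rfl | rfl)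
  exacts [hx, hy]

theorem span_two_three_four_five (F : Basis (Fin 5) ℝ g) :
    Submodule.span ℝ {F 2, F 3, F 4, F 5} = LinearMap.ker (e F 1) := by
  refine le_antisymm (span_le_of_four ?_ ?_ ?_ ?_) fun x hx => ?_
  · simp [e_basis]
  · simp [e_basis]
  · simp [e_basis]
  · simp [e_basis]
  have hx : e F 1 x = 0 := hx
  have : x = e F 2 x • F 2 + e F 3 x • F 3 + e F 4 x • F 4 + e F 5 x • F 5 := by
    refine ext_coord F ?_ ?_ ?_ ?_ ?_ <;> simp [e_basis, hx]
  rw [this]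
  refine add_mem (add_mem (add_mem ?_ ?_) ?_) ?_ <;>
    exact Submodule.smul_mem _ _ (Submodule.subset_span (by simp))

/-! ### Structure equations with a closed first form -/

/-- The cubic relations between the six remaining coefficients when `A = 0`, as `p = B₁₂`, `b =
B₁₃`, `m = B₁₄`, `s = B₃₄`, `q = C₁₃`, `c = C₁₄`. They are linear combinations of the components
of the Jacobi identity, chosen so that `cp` and `mq` factor. -/
structure ReducedRelations (p b m s q c : ℝ) : Prop where
  cp : (p + s) * (c * p - b * m) = 0
  mq : (p + s) * (m * q - b * c) = 0
  bm : b * (m ^ 2 + b ^ 2 - p * q) = c * m * p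
  bs : b * s * (p - q + s) = b * p * q + c * m * (p + s)
  cubic₁ : b * m * (q - s) - b ^ 2 * c + c * p * s = 0
  cubic₂ : b ^ 2 * m - b * c * (q - s) - m * (p * q + q * s - q ^ 2) = 0
  cubic₃ : 4 * b * c * m + b ^ 2 * q - 3 * b ^ 2 * s + c ^ 2 * s - 3 * m ^ 2 * q + 2 * p * q * s
    - q * s ^ 2 + q ^ 2 * s = 0
  cubic₄ : -b ^ 2 * p + b ^ 2 * q + c ^ 2 * s - m ^ 2 * p + m ^ 2 * q - m ^ 2 * s - 2 * p * q * s
    + p * s ^ 2 + p ^ 2 * s - q * s ^ 2 + q ^ 2 * s = 0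
  cubic₅ : -4 * b * c * m + 2 * b ^ 2 * p - 3 * b ^ 2 * q + 3 * b ^ 2 * s + 3 * c ^ 2 * p
    - m ^ 2 * p + m ^ 2 * q - m ^ 2 * s - 4 * p * q * s + 3 * p * q ^ 2 + p * s ^ 2
    - 3 * p ^ 2 * q + p ^ 2 * s = 0

/-- The general equations with `A = 0` and with `B₁₅`, `B₂₅`, `B₃₅`, `C₁₅`, `C₂₅`, `D₁₅` expressed
by the remaining six coefficients through the Jacobi identity. -/
def ReducedEquations (E : Basis (Fin 5) ℝ g) (p b m s q c : ℝ) : Prop :=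
  StructureEquations E 0 p b m ((p * m - 2 * b * c + m * s + 2 * m * q) / 2)
    ((p * b + 3 * b * s - 2 * b * q - 2 * m * c) / 2) s
    ((-p * s + 2 * b ^ 2 + 2 * m ^ 2 + s ^ 2) / 2) q c ((3 * p * c - 2 * b * m + s * c) / 2)
    ((-2 * p * s + 3 * p * q - p ^ 2 - 2 * b ^ 2 + 3 * s * q - s ^ 2 - 2 * q ^ 2 - 2 * c ^ 2) / 2)
    ((p * s - 3 * p * q - p ^ 2 - 2 * m ^ 2 + s * q - 2 * q ^ 2 - 2 * c ^ 2) / 2)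

theorem StructureEquations.reduced {E : Basis (Fin 5) ℝ g}
    {p b m B₁₅ B₂₅ s B₃₅ q c C₁₅ C₂₅ D₁₅ : ℝ}
    (h : StructureEquations E 0 p b m B₁₅ B₂₅ s B₃₅ q c C₁₅ C₂₅ D₁₅) :
    ReducedEquations E p b m s q c := by
  have J := h.jacobi
  unfold ReducedEquations
  convert h using 1
  · linear_combination (-1 / 2) * J.d2_123
  · linear_combination (1 / 2) * J.d2_124
  · linear_combination (1 / 2) * J.d2_134
  · linear_combination (-1 / 2) * J.d3_123
  · linear_combination (1 / 2) * J.d3_124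
  · linear_combination (-1 / 2) * J.d4_123

theorem ReducedEquations.relations {E : Basis (Fin 5) ℝ g} {p b m s q c : ℝ}
    (h : ReducedEquations E p b m s q c) : ReducedRelations p b m s q c := by
  have J := StructureEquations.jacobi h
  constructor
  · linear_combination (-1 / 3) * J.d2_145 + (1 / 3) * J.d4_125
  · linear_combination (1 / 3) * J.d3_145 + (-1 / 3) * J.d4_135
  · linear_combination (1 / 3) * J.d2_125 + (-1 / 6) * J.d2_345
  · linear_combination (1 / 3) * J.d2_125 + (1 / 3) * J.d2_345
  · linear_combination (-1 / 2) * J.d2_145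
  · linear_combination (-1 / 2) * J.d3_145
  · linear_combination (-1) * J.d2_135
  · linear_combination J.d2_245
  · linear_combination (-1) * J.d3_125

/-- If `p + s = 0`, the symmetric matrix with rows `(p, b)` and `(b, q)` is singular. -/
theorem ReducedRelations.sq_eq {p b m s q c : ℝ} (h : ReducedRelations p b m s q c)
    (hps : p + s = 0) : b ^ 2 = p * q := by
  obtain rfl : s = -p := by linarith
  -- `cubic₁` and `cubic₂` are a linear system for `(m, c)` with determinant `(b ^ 2 - p * q) ^ 2`
  have h1 : m * (b ^ 2 - p * q) ^ 2 = 0 := by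
    linear_combination (b ^ 2 + p ^ 2) * h.cubic₂ - b * (p + q) * h.cubic₁
  have h2 : c * (b ^ 2 - p * q) ^ 2 = 0 := by
    linear_combination b * (p + q) * h.cubic₂ - (b ^ 2 + q ^ 2) * h.cubic₁
  by_contra hne
  have hne' : b ^ 2 - p * q ≠ 0 := sub_ne_zero.2 hne
  obtain rfl : m = 0 := by simpa [hne'] using h1
  obtain rfl : c = 0 := by simpa [hne'] using h2
  have hb : b * (b ^ 2 - p * q) = 0 := by linear_combination h.bm
  obtain rfl : b = 0 := by simpa [hne'] using hb
  have hpq : (q - p) * (p * q) = 0 := by linear_combination -h.cubic₄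
  have hpq' : p * q ≠ 0 := by simpa using hne'
  have : q = p := by simpa [hpq', sub_eq_zero] using hpq
  subst this
  have h3 : q ^ 3 = 0 := by linear_combination (-1 / 4) * h.cubic₃
  simp_all

/-- The solutions with `p + s ≠ 0`: those of the first two families, and a branch on which the
matrix with rows `(p, b)` and `(b, q)` is singular. The Lie algebras of that branch are solvable
only if `s = q`, by `ReducedEquations.eq_of_isSolvable`. -/
theorem ReducedRelations.trichotomy {p b m s q c : ℝ} (h : ReducedRelations p b m s q c)
    (hps : p + s ≠ 0) :
    (b = 0 ∧ m = 0 ∧ c = 0 ∧ s = 0 ∧ q = p) ∨ (b = 0 ∧ m = 0 ∧ c = 0 ∧ s = 3 * p ∧ q = p) ∨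
    (p * q = b ^ 2 ∧ m ^ 2 = p * (s - q) ∧ c ^ 2 = q * (s - q) ∧ c * m = b * (s - q) ∧
      c * p = b * m ∧ m * q = b * c) := by
  have cp : c * p = b * m := by simpa [hps, sub_eq_zero] using h.cp
  have mq : m * q = b * c := by simpa [hps, sub_eq_zero] using h.mq
  have hb : b * (b ^ 2 - p * q) = 0 := by linear_combination h.bm + m * cp
  have cm : c * m = b * (s - q) := by
    have : (p + s) * (c * m - b * (s - q)) = 0 := by linear_combination -h.bs
    simpa [hps, sub_eq_zero] using this
  by_cases b0 : b = 0
  · subst b0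
    simp only [zero_mul, mul_eq_zero] at cp mq cm
    by_cases c0 : c = 0
    · subst c0
      by_cases m0 : m = 0
      · subst m0
        have k1 : s * (q * (2 * p + q - s)) = 0 := by linear_combination h.cubic₃
        have k2 : s * ((p - q) * (p - q + s)) = 0 := by linear_combination h.cubic₄
        have k3 : p * ((s - 3 * q) * (s - q + p)) = 0 := by linear_combination h.cubic₅
        by_cases s0 : s = 0
        · subst s0
          have p0 : p ≠ 0 := by simpa using hps
          have : q * (p - q) = 0 := by
            have : p * (q * (p - q)) = 0 := by linear_combination (-1 / 3) * k3
            simpa [p0] using this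
          rcases mul_eq_zero.1 this with rfl | hq
          · right; right; simp
          · left; simp; linarith
        · have k1' : q * (2 * p + q - s) = 0 := by simpa [s0] using k1
          have k2' : (p - q) * (p - q + s) = 0 := by simpa [s0] using k2
          rcases mul_eq_zero.1 k1' with rfl | hq
          · have : p = 0 := by
              have : p * (p + s) = 0 := by linear_combination k2'
              simpa [hps] using this
            right; right; simp [this]
          · obtain rfl : s = 2 * p + q := by linarith
            have : p * (p - q) = 0 := by linear_combination (1 / 3) * k2'
            rcases mul_eq_zero.1 this with rfl | hq
            · right; right; simp
            · obtain rfl : q = p := by linarith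
              right; left; simp; ring
      · have q0 : q = 0 := by simpa [m0] using mq
        subst q0
        have : (p + s) * (m ^ 2 - p * s) = 0 := by linear_combination -h.cubic₄
        have : m ^ 2 = p * s := by simpa [hps, sub_eq_zero] using this
        right; right; simp [this]
    · have p0 : p = 0 := by simpa [c0] using cp
      have m0 : m = 0 := by simpa [c0] using cm
      subst p0 m0
      have s0 : s ≠ 0 := by simpa using hps
      have : s * (c ^ 2 - q * (s - q)) = 0 := by linear_combination h.cubic₄
      have : c ^ 2 = q * (s - q) := by simpa [s0, sub_eq_zero] using this
      right; right; simp [this]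
  · have pq : b ^ 2 = p * q := by simpa [b0, sub_eq_zero] using hb
    refine Or.inr (Or.inr ⟨pq.symm, ?_, ?_, cm, cp, mq⟩)
    · refine mul_left_cancel₀ b0 ?_
      linear_combination -m * cp + p * cm
    · refine mul_left_cancel₀ b0 ?_
      linear_combination -c * mq + q * cm

/-- On the third branch of `ReducedRelations.trichotomy`, the forms `e²`, `e³` and `f = e⁴ + (p +
s) / 2 • e⁵`, restricted to the kernel of `e¹`, generate an ideal of forms closed under `d`. The
brackets of the dual 3-dimensional quotient are given by a matrix of determinant `(s - q) (p +
s)²`, so the quotient is perfect unless `s = q`. -/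
theorem ReducedEquations.eq_of_isSolvable [LieAlgebra.IsSolvable g] {E : Basis (Fin 5) ℝ g}
    {p b m s q c : ℝ} (h : ReducedEquations E p b m s q c) (hps : p + s ≠ 0)
    (hm : m ^ 2 = p * (s - q)) (hc : c ^ 2 = q * (s - q)) (hpq : p * q = b ^ 2)
    (hcm : c * m = b * (s - q)) (hcp : c * p = b * m) (hmq : m * q = b * c) : s = q := by
  by_contra hsq
  obtain ⟨h1, h2, h3, h4, h5⟩ := h
  have h2 (x y) := LinearMap.congr_fun₂ h2 x y
  have h3 (x y) := LinearMap.congr_fun₂ h3 x y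
  have h4 (x y) := LinearMap.congr_fun₂ h4 x y
  have h5 (x y) := LinearMap.congr_fun₂ h5 x y
  simp only [five_eq_zero, LinearMap.add_apply, LinearMap.sub_apply, LinearMap.smul_apply,
    smul_eq_mul, ee_apply] at h2 h3 h4 h5
  refine not_perfect_subquotient (e E 1) (e E 2) (e E 3) (e E 4 + ((p + s) / 2) • e E 5)
    (x₁ := E 2) (x₂ := E 3) (x₃ := E 4) (by simp [e_basis]) (by simp [e_basis])
    (by simp [e_basis]) !![m, -b, -s; c, p + s - q, b; s - q, -c, m] ?_ ?_ ?_ ?_ ?_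
  · have : (!![m, -b, -s; c, p + s - q, b; s - q, -c, m] : Matrix (Fin 3) (Fin 3) ℝ).det
        = (s - q) * (p + s) ^ 2 := by
      rw [Matrix.det_fin_three]
      simp
      linear_combination (p + s - q) * hm + 2 * b * hcm + s * hc - (s - q) * hpq
    rw [this]
    exact mul_ne_zero (sub_ne_zero.2 hsq) (pow_ne_zero 2 hps)
  · intro x y
    rw [e_bracket, h1]
    simp
  · intro x y hx hy
    simp [e_bracket, h2, hx, hy, five_eq_zero]
    linear_combination (e E 2 x * e E 0 y - e E 0 x * e E 2 y) * hcm
      + (e E 3 x * e E 0 y - e E 0 x * e E 3 y) * (hpq - hm)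
  · intro x y hx hy
    simp [e_bracket, h3, hx, hy, five_eq_zero]
    linear_combination (e E 2 x * e E 0 y - e E 0 x * e E 2 y) * (hc - hpq)
      - (e E 3 x * e E 0 y - e E 0 x * e E 3 y) * hcm
  · intro x y hx hy
    simp [e_bracket, h4, h5, hx, hy, five_eq_zero]
    linear_combination -(e E 2 x * e E 0 y - e E 0 x * e E 2 y) * hcp
      + (e E 3 x * e E 0 y - e E 0 x * e E 3 y) * hmq

/-! ### The families as solutions -/

/-- The structure equations of the basis are those of one of the six families. -/
def InSomeFamily (E : Basis (Fin 5) ℝ g) : Prop :=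
  (∃ r : ℝ, r ≠ 0 ∧ Family1 E r) ∨
  (∃ r : ℝ, r ≠ 0 ∧ Family2 E r) ∨
  (∃ a r : ℝ, r ≠ 0 ∧ Family3 E a r) ∨
  (∃ a b : ℝ, Family4 E a b) ∨
  (∃ r : ℝ, r ≠ 0 ∧ Family5 E r) ∨
  (∃ r a : ℝ, r ≠ 0 ∧ Family6 E r a)

/-- With `p + s ≠ 0` the equations are those of family 1, 2, 5 or 6. -/
theorem ReducedEquations.inSomeFamily_of_ne [LieAlgebra.IsSolvable g] {E : Basis (Fin 5) ℝ g}
    {p b m s q c : ℝ} (h : ReducedEquations E p b m s q c) (hps : p + s ≠ 0) :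
    InSomeFamily E := by
  rcases h.relations.trichotomy hps with ⟨rfl, rfl, rfl, rfl, rfl⟩ | ⟨rfl, rfl, rfl, rfl, rfl⟩ |
    ⟨hpq, hm, hc, hcm, hcp, hmq⟩
  · obtain ⟨h1, h2, h3, h4, h5⟩ := h
    refine Or.inl ⟨q, by simpa using hps, ?_, ?_, ?_, ?_, h5⟩
    · rw [h1]; module
    · rw [h2]; module
    · rw [h3]; module
    · rw [h4]; module
  · obtain ⟨h1, h2, h3, h4, h5⟩ := h
    refine Or.inr (Or.inl ⟨q, fun h0 => hps (by simp [h0]), ?_, ?_, ?_, ?_, h5⟩)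
    · rw [h1]; module
    · rw [h2]; module
    · rw [h3]; module
    · rw [h4, h5]; module
  · obtain rfl : s = q := h.eq_of_isSolvable hps hm hc hpq hcm hcp hmq
    obtain rfl : m = 0 := by simpa using hm
    obtain rfl : c = 0 := by simpa using hc
    obtain ⟨h1, h2, h3, h4, h5⟩ := h
    by_cases p0 : p = 0
    · subst p0
      obtain rfl : b = 0 := by simpa using hpq.symm
      refine Or.inr (Or.inr (Or.inr (Or.inr (Or.inl ⟨s, by simpa using hps, ?_, ?_, ?_, ?_, h5⟩))))
      · rw [h1]; module
      · rw [h2]; module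
      · rw [h3]; module
      · rw [h4]; module
    · obtain rfl : s = b ^ 2 / p := by field_simp; linarith
      refine Or.inr (Or.inr (Or.inr (Or.inr (Or.inr ⟨p, b, p0, ?_, ?_, ?_, ?_, h5⟩))))
      · rw [h1]; module
      · rw [h2]; match_scalars <;> field_simp <;> ring
      · rw [h3]; match_scalars <;> field_simp <;> ring
      · rw [h4]; match_scalars <;> field_simp <;> ring

/-- With `p + s = 0` and `p + q = 0` the relation `b² = p q` leaves only `m` and `c`: these are
families 3 and 4. -/
theorem ReducedEquations.inSomeFamily_of_add_eq_zero {E : Basis (Fin 5) ℝ g}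
    {p b m s q c : ℝ} (h : ReducedEquations E p b m s q c) (hps : p + s = 0) (hpq : p + q = 0) :
    InSomeFamily E := by
  have hb := h.relations.sq_eq hps
  obtain rfl : s = -p := by linarith
  obtain rfl : q = -p := by linarith
  have hsum : b ^ 2 + p ^ 2 = 0 := by linear_combination hb
  obtain rfl : b = 0 := by nlinarith [sq_nonneg b, sq_nonneg p]
  obtain rfl : p = 0 := by simpa using hsum
  obtain ⟨h1, h2, h3, h4, h5⟩ := h
  by_cases m0 : m = 0
  · subst m0
    refine Or.inr (Or.inr (Or.inr (Or.inl ⟨0, c, ?_, ?_, ?_, ?_, h5⟩)))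
    · rw [h1]; module
    · rw [h2]; module
    · rw [h3]; module
    · rw [h4]; module
  · refine Or.inr (Or.inr (Or.inl ⟨c, m, m0, ?_, ?_, ?_, ?_, h5⟩))
    · rw [h1]; module
    · rw [h2]; module
    · rw [h3, h2]; match_scalars <;> field_simp <;> ring
    · rw [h4]; module

/-- With `p = s = 0` the equations are those of family 3 or 4. -/
theorem ReducedEquations.inSomeFamily_of_eq_zero {E : Basis (Fin 5) ℝ g}
    {b m q c : ℝ} (h : ReducedEquations E 0 b m 0 q c) : InSomeFamily E := by
  by_cases q0 : q = 0
  · exact h.inSomeFamily_of_add_eq_zero (by simp) (by simp [q0])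
  obtain rfl : b = 0 := by simpa using h.relations.sq_eq (by simp)
  obtain rfl : m = 0 := by simpa [q0] using h.relations.cubic₂
  obtain ⟨h1, h2, h3, h4, h5⟩ := h
  refine Or.inr (Or.inr (Or.inr (Or.inl ⟨q, c, ?_, ?_, ?_, ?_, h5⟩)))
  · rw [h1]; module
  · rw [h2]; module
  · rw [h3]; module
  · rw [h4]; module

/-! ### Rotation to a normal form -/

/-- The rotation that ends the case `p + s = 0`, `p ≠ 0`. There `u₁ de³ = u₂ de²`, so that the
form `x e¹ + σ (u₂ e² - u₁ e³)` is closed for every point `(x, σ)` of the circle. For `(x, σ) =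
(cos θ, sin θ)` the new value of `p + q` is `t cos 3θ - k sin 3θ`, so `θ` can be chosen to make it
vanish. -/
theorem ReducedEquations.rotate {E : Basis (Fin 5) ℝ g} {t k u₁ u₂ x σ : ℝ}
    (h : ReducedEquations E (t * u₁ ^ 2) (t * (u₁ * u₂)) (k * u₁) (-(t * u₁ ^ 2)) (t * u₂ ^ 2)
      (k * u₂))
    (hu : u₁ ^ 2 + u₂ ^ 2 = 1) (ht : t * (x ^ 3 - 3 * x * σ ^ 2) = k * (3 * x ^ 2 * σ - σ ^ 3))
    (hr : x ^ 2 + (σ * u₂) ^ 2 + (-(σ * u₁)) ^ 2 + 0 ^ 2 = 1) :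
    d (e (HypoContact.rotate E hr) 1) = 0 ∧
      d (e (HypoContact.rotate E hr) 4) (HypoContact.rotate E hr 2) (HypoContact.rotate E hr 3)
        = 0 := by
  obtain ⟨h1, h2, h3, h4, -⟩ := h
  have h1 (v w) := LinearMap.congr_fun₂ h1 v w
  have h2 (v w) := LinearMap.congr_fun₂ h2 v w
  have h3 (v w) := LinearMap.congr_fun₂ h3 v w
  have h4 (v w) := LinearMap.congr_fun₂ h4 v w
  simp only [five_eq_zero, LinearMap.add_apply, LinearMap.sub_apply, LinearMap.smul_apply,
    smul_eq_mul, ee_apply] at h1 h2 h3 h4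
  constructor
  · ext v w
    rw [e_rotate_one, d_apply]
    simp only [LinearMap.add_apply, LinearMap.smul_apply, smul_eq_mul, e_bracket, h1, h2,
      h3, LinearMap.zero_apply]
    ring
  · rw [e_rotate_four, rotate_two, rotate_three, d_apply]
    simp only [LinearMap.add_apply, LinearMap.sub_apply, LinearMap.smul_apply, smul_eq_mul,
      e_bracket, h1, h2, h3, h4, map_add, map_sub, map_smul]
    simp [e_basis]
    linear_combination ht + (k * u₁ ^ 2 * σ ^ 3 + k * u₂ ^ 2 * σ ^ 3 - 3 * t * u₁ ^ 2 * x * σ ^ 2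
      - 3 * t * u₂ ^ 2 * x * σ ^ 2 - 3 * k * x ^ 2 * σ + k * σ ^ 3 - 3 * t * x * σ ^ 2
      + t * x ^ 3) * hu

/-- An angle `θ` with `t cos 3θ = k sin 3θ`, in terms of `x = cos θ` and `σ = sin θ`. -/
theorem exists_trisection (t k : ℝ) : ∃ x σ : ℝ, x ^ 2 + σ ^ 2 = 1 ∧
    t * (x ^ 3 - 3 * x * σ ^ 2) = k * (3 * x ^ 2 * σ - σ ^ 3) := by
  obtain ⟨φ, hφ⟩ : ∃ φ : ℝ, t * Real.cos φ = k * Real.sin φ := by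
    by_cases k0 : k = 0
    · exact ⟨Real.pi / 2, by simp [k0]⟩
    · refine ⟨Real.arctan (t / k), ?_⟩
      rw [← Real.tan_mul_cos (Real.cos_arctan_pos _).ne', Real.tan_arctan]
      field_simp
  have h1 := Real.cos_sq_add_sin_sq (φ / 3)
  have hc := Real.cos_three_mul (φ / 3)
  have hs := Real.sin_three_mul (φ / 3)
  rw [mul_div_cancel₀ φ three_ne_zero] at hc hs
  rw [hc, hs] at hφ
  refine ⟨Real.cos (φ / 3), Real.sin (φ / 3), h1, ?_⟩
  linear_combination hφ - (3 * t * Real.cos (φ / 3) + 3 * k * Real.sin (φ / 3)) * h1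

variable {η : Dual ℝ g} {ω₁ ω₂ ω₃ : LinearMap.BilinForm ℝ g}

theorem IsHypoContact.reducedEquations (hη : IsHypoContact η ω₁ ω₂ ω₃) {E : Basis (Fin 5) ℝ g}
    (hE : IsAdapted E η ω₁ ω₂ ω₃) (h1 : d (e E 1) = 0) :
    ∃ p b m s q c : ℝ, ReducedEquations E p b m s q c := by
  obtain ⟨_, _, _, _, _, _, _, _, _, _, _, _, h⟩ := hη.structureEquations hE h1
  exact ⟨_, _, _, _, _, _, h.reduced⟩

/-- The classification when `e¹` is closed. -/
theorem IsHypoContact.exists_inSomeFamily_of_closed [LieAlgebra.IsSolvable g]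
    (hη : IsHypoContact η ω₁ ω₂ ω₃) {E : Basis (Fin 5) ℝ g}
    (hE : IsAdapted E η ω₁ ω₂ ω₃) (h1 : d (e E 1) = 0) :
    ∃ F : Basis (Fin 5) ℝ g, IsAdapted F η ω₁ ω₂ ω₃ ∧ InSomeFamily F := by
  obtain ⟨p, b, m, s, q, c, h⟩ := hη.reducedEquations hE h1
  by_cases hps : p + s = 0
  swap
  · exact ⟨E, hE, h.inSomeFamily_of_ne hps⟩
  obtain rfl : s = -p := by linarith
  by_cases p0 : p = 0
  · subst p0
    rw [neg_zero] at h
    exact ⟨E, hE, h.inSomeFamily_of_eq_zero⟩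
  have hb := h.relations.sq_eq hps
  have hpos : 0 < p ^ 2 + b ^ 2 := by positivity
  have hpq : p + q ≠ 0 := fun h0 => hpos.ne' (by linear_combination p * h0 + hb)
  have hcp : c * p = b * m := by
    have : (p + q) * (b * m - c * p) = 0 := by
      linear_combination h.relations.cubic₁ + c * hb
    have := (mul_eq_zero.1 this).resolve_left hpq
    linarith
  set ρ := √(p ^ 2 + b ^ 2) with hρ
  have hρ2 : ρ ^ 2 = p ^ 2 + b ^ 2 := Real.sq_sqrt hpos.le
  have hρ0 : ρ ≠ 0 := (Real.sqrt_pos.2 hpos).ne'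
  -- the rank-one matrix is `(p + q) • u uᵀ` with `u = (p / ρ, b / ρ)`, and `(m, c)` is
  -- parallel to `u`
  have hpt : p * (p + q) = ρ ^ 2 := by linear_combination -hρ2 - hb
  have hu : (p / ρ) ^ 2 + (b / ρ) ^ 2 = 1 := by field_simp; linarith
  obtain ⟨x, σ, hxσ, ht⟩ := exists_trisection (p + q) (m * ρ / p)
  have hr : x ^ 2 + (σ * (b / ρ)) ^ 2 + (-(σ * (p / ρ))) ^ 2 + 0 ^ 2 = 1 := by
    linear_combination hxσ + σ ^ 2 * hu
  have h' : ReducedEquations E ((p + q) * (p / ρ) ^ 2) ((p + q) * (p / ρ * (b / ρ)))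
      (m * ρ / p * (p / ρ)) (-((p + q) * (p / ρ) ^ 2)) ((p + q) * (b / ρ) ^ 2)
      (m * ρ / p * (b / ρ)) := by
    have e1 : (p + q) * (p / ρ) ^ 2 = p := by
      field_simp; linear_combination hpt
    have e2 : (p + q) * (p / ρ * (b / ρ)) = b := by
      field_simp; linear_combination b * hpt
    have e3 : m * ρ / p * (p / ρ) = m := by field_simp
    have e4 : (p + q) * (b / ρ) ^ 2 = q := by
      field_simp; linear_combination (p + q) * hb + q * hpt
    have e5 : m * ρ / p * (b / ρ) = c := by
      field_simp; linear_combination -hcp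
    rwa [e1, e2, e3, e4, e5]
  obtain ⟨hF1, hF4⟩ := h'.rotate hu ht hr
  have hF := hE.rotate hr
  obtain ⟨p', b', m', s', q', c', hF'⟩ := hη.reducedEquations hF hF1
  -- `p' + q'` is the coefficient of `e²³` in `de⁴`
  have hpq' : p' + q' = 0 := by
    rw [hF'.2.2.2.1] at hF4
    simpa [ee_apply, e_basis, five_eq_zero] using hF4
  refine ⟨_, hF, ?_⟩
  by_cases hps' : p' + s' = 0
  · exact hF'.inSomeFamily_of_add_eq_zero hps' hpq'
  · exact hF'.inSomeFamily_of_ne hps'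

/-- For `A ≠ 0` the Jacobi identity forces `de⁴` to be a multiple of `ω₃`, like `de¹`; so a
combination of `e¹` and `e⁴` is closed, and a rotation makes it the first form of the basis. -/
theorem GeneralEquations.exists_closed {E : Basis (Fin 5) ℝ g} (hd : GeneralEquations E)
    (hE : IsAdapted E η ω₁ ω₂ ω₃) :
    ∃ F : Basis (Fin 5) ℝ g, IsAdapted F η ω₁ ω₂ ω₃ ∧ d (e F 1) = 0 := by
  obtain ⟨A, p, b, m, B₁₅, B₂₅, s, B₃₅, q, c, C₁₅, C₂₅, D₁₅, h⟩ := hd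
  have J := StructureEquations.jacobi h
  obtain ⟨h1, -, -, h4, -⟩ := h
  by_cases A0 : A = 0
  · exact ⟨E, hE, by rw [h1, A0]; module⟩
  obtain rfl : m = 0 := by
    refine mul_left_cancel₀ A0 ?_
    linear_combination (1 / 2) * J.d2_234
  obtain rfl : c = 0 := by
    refine mul_left_cancel₀ A0 ?_
    linear_combination (1 / 2) * J.d3_234
  obtain rfl : s = p + 2 * q := by
    refine mul_left_cancel₀ A0 ?_
    linear_combination J.d4_234
  obtain rfl : B₁₅ = 0 := by linear_combination (1 / 2) * J.d2_123
  obtain rfl : C₁₅ = 0 := by linear_combination (1 / 2) * J.d3_123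
  obtain rfl : D₁₅ = 0 := by
    refine mul_left_cancel₀ A0 ?_
    linear_combination J.d4_145
  have hpos : 0 < A ^ 2 + (p + q) ^ 2 := by positivity
  set ρ := √(A ^ 2 + (p + q) ^ 2) with hρ
  have hρ2 : ρ ^ 2 = A ^ 2 + (p + q) ^ 2 := Real.sq_sqrt hpos.le
  have hρ0 : ρ ≠ 0 := (Real.sqrt_pos.2 hpos).ne'
  have hr : ((p + q) / ρ) ^ 2 + 0 ^ 2 + 0 ^ 2 + (-(A / ρ)) ^ 2 = 1 := by
    field_simp
    linear_combination -hρ2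
  refine ⟨_, hE.rotate hr, ?_⟩
  have h1 (v w) := LinearMap.congr_fun₂ h1 v w
  have h4 (v w) := LinearMap.congr_fun₂ h4 v w
  simp only [LinearMap.add_apply, LinearMap.sub_apply, LinearMap.smul_apply, smul_eq_mul]
    at h1 h4
  ext v w
  rw [e_rotate_one, d_apply]
  simp only [LinearMap.add_apply, LinearMap.smul_apply, smul_eq_mul, e_bracket, h1, h4,
    LinearMap.zero_apply]
  ring

/-! ### Derived series of the families -/

section families

variable {F : Basis (Fin 5) ℝ g}

theorem Family1.derived {r : ℝ} (r0 : r ≠ 0) (h : Family1 F r) :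
    derived g 1 = Submodule.span ℝ {F 2, F 3, F 4, F 5} ∧
      derived g 2 = Submodule.span ℝ {r • F 4 - F 5} ∧ derived g 3 = ⊥ := by
  obtain ⟨h1, h2, h3, h4, h5⟩ := h
  have h1 (x y) := LinearMap.congr_fun₂ h1 x y
  have h2 (x y) := LinearMap.congr_fun₂ h2 x y
  have h3 (x y) := LinearMap.congr_fun₂ h3 x y
  have h4 (x y) := LinearMap.congr_fun₂ h4 x y
  have h5 (x y) := LinearMap.congr_fun₂ h5 x y
  simp only [five_eq_zero, LinearMap.add_apply, LinearMap.sub_apply, LinearMap.smul_apply,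
    LinearMap.zero_apply, smul_eq_mul, ee_apply] at h1 h2 h3 h4 h5
  have D1 : HypoContact.derived g 1 = Submodule.span ℝ {F 2, F 3, F 4, F 5} := by
    refine le_antisymm ?_ (span_le_of_four ?_ ?_ ?_ ?_)
    · rw [span_two_three_four_five]
      exact derived_one_le fun x y => by simp [e_bracket, h1]
    · have : F 2 = (-1 / r) • ⁅F 1, F 2⁆ := by
        refine ext_coord F ?_ ?_ ?_ ?_ ?_ <;>
          simp [five_eq_zero, e_bracket, e_basis, h1, h2, h3, h4, h5]
        field_simp
      rw [this]
      exact Submodule.smul_mem _ _ (lie_mem_derived_one _ _)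
    · have : F 3 = (-1 / r) • ⁅F 1, F 3⁆ := by
        refine ext_coord F ?_ ?_ ?_ ?_ ?_ <;>
          simp [five_eq_zero, e_bracket, e_basis, h1, h2, h3, h4, h5]
        field_simp
      rw [this]
      exact Submodule.smul_mem _ _ (lie_mem_derived_one _ _)
    · have : F 4 = (1 / (3 * r ^ 2)) • ⁅F 1, F 5⁆ := by
        refine ext_coord F ?_ ?_ ?_ ?_ ?_ <;>
          simp [five_eq_zero, e_bracket, e_basis, h1, h2, h3, h4, h5]
        field_simp
      rw [this]
      exact Submodule.smul_mem _ _ (lie_mem_derived_one _ _)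
    · have : F 5 = (1 / 2 : ℝ) • ⁅F 1, F 4⁆ - (1 / (6 * r)) • ⁅F 1, F 5⁆ := by
        refine ext_coord F ?_ ?_ ?_ ?_ ?_ <;>
          simp [five_eq_zero, e_bracket, e_basis, h1, h2, h3, h4, h5]
        field_simp
        ring
      rw [this]
      exact sub_mem (Submodule.smul_mem _ _ (lie_mem_derived_one _ _))
        (Submodule.smul_mem _ _ (lie_mem_derived_one _ _))
  have D2 : HypoContact.derived g 2 = Submodule.span ℝ {r • F 4 - F 5} := by
    refine le_antisymm (derived_succ_le fun x hx y hy => ?_) ?_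
    · rw [D1, span_two_three_four_five, LinearMap.mem_ker] at hx hy
      refine Submodule.mem_span_singleton.2
        ⟨-2 * (e F 2 x * e F 3 y - e F 3 x * e F 2 y), ext_coord F ?_ ?_ ?_ ?_ ?_⟩ <;>
        simp [five_eq_zero, e_bracket, e_basis, h1, h2, h3, h4, h5, hx, hy]
      ring
    · rw [Submodule.span_singleton_le_iff_mem]
      have : r • F 4 - F 5 = (-1 / 2 : ℝ) • ⁅F 2, F 3⁆ := by
        refine ext_coord F ?_ ?_ ?_ ?_ ?_ <;>
          simp [five_eq_zero, e_bracket, e_basis, h1, h2, h3, h4, h5]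
        ring
      rw [this]
      refine Submodule.smul_mem _ _ (mem_derived_succ ?_ ?_) <;> rw [D1]
      · exact Submodule.subset_span (by simp)
      · exact Submodule.subset_span (by simp)
  exact ⟨D1, D2, derived_succ_eq_bot_of_singleton D2⟩
theorem Family2.derived {r : ℝ} (r0 : r ≠ 0) (h : Family2 F r) :
    derived g 1 = Submodule.span ℝ {F 2, F 3, r • F 4 - F 5} ∧
      derived g 2 = Submodule.span ℝ {r • F 4 - F 5} ∧ derived g 3 = ⊥ := by
  obtain ⟨h1, h2, h3, h4, h5⟩ := h
  rw [h5] at h4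
  have h1 (x y) := LinearMap.congr_fun₂ h1 x y
  have h2 (x y) := LinearMap.congr_fun₂ h2 x y
  have h3 (x y) := LinearMap.congr_fun₂ h3 x y
  have h4 (x y) := LinearMap.congr_fun₂ h4 x y
  have h5 (x y) := LinearMap.congr_fun₂ h5 x y
  simp only [five_eq_zero, LinearMap.add_apply, LinearMap.sub_apply, LinearMap.smul_apply,
    LinearMap.zero_apply, smul_eq_mul, ee_apply] at h1 h2 h3 h4 h5
  have D1 : HypoContact.derived g 1 = Submodule.span ℝ {F 2, F 3, r • F 4 - F 5} := by
    refine le_antisymm (derived_one_le fun x y => ?_) (span_le_of_three ?_ ?_ ?_)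
    · refine Submodule.mem_span_triple.2 ⟨e F 2 ⁅x, y⁆,
        e F 3 ⁅x, y⁆,
        -e F 5 ⁅x, y⁆, ext_coord F ?_ ?_ ?_ ?_ ?_⟩ <;>
        simp [five_eq_zero, e_bracket, e_basis, h1, h2, h3, h4, h5]
      all_goals field_simp
      all_goals ring
    · have : F 2 = (-1 / r) • ⁅F 1, F 2⁆ := by
        refine ext_coord F ?_ ?_ ?_ ?_ ?_ <;>
          simp [five_eq_zero, e_bracket, e_basis, h1, h2, h3, h4, h5]
        all_goals field_simp
      rw [this]
      exact Submodule.smul_mem _ _ (lie_mem_derived_one _ _)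
    · have : F 3 = (-1 / r) • ⁅F 1, F 3⁆ := by
        refine ext_coord F ?_ ?_ ?_ ?_ ?_ <;>
          simp [five_eq_zero, e_bracket, e_basis, h1, h2, h3, h4, h5]
        all_goals field_simp
      rw [this]
      exact Submodule.smul_mem _ _ (lie_mem_derived_one _ _)
    · have : r • F 4 - F 5 = (-1 / 2 : ℝ) • ⁅F 2, F 3⁆ := by
        refine ext_coord F ?_ ?_ ?_ ?_ ?_ <;>
          simp [five_eq_zero, e_bracket, e_basis, h1, h2, h3, h4, h5]
        all_goals field_simp
      rw [this]
      exact Submodule.smul_mem _ _ (lie_mem_derived_one _ _)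
  have hker (x : g) (hx : x ∈ HypoContact.derived g 1) : e F 1 x = 0 ∧ e F 4 x = -r * e F 5 x := by
    rw [D1] at hx
    obtain ⟨a, b, c, rfl⟩ := Submodule.mem_span_triple.1 hx
    constructor <;> simp [e_basis, five_eq_zero]
    ring
  have D2 : HypoContact.derived g 2 = Submodule.span ℝ {r • F 4 - F 5} := by
    refine le_antisymm (derived_succ_le fun x hx y hy => ?_) ?_
    · obtain ⟨hx1, hx4⟩ := hker x hx
      obtain ⟨hy1, hy4⟩ := hker y hy
      rw [five_eq_zero] at hx4 hy4
      refine Submodule.mem_span_singleton.2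
        ⟨-2 * (e F 2 x * e F 3 y - e F 3 x * e F 2 y), ext_coord F ?_ ?_ ?_ ?_ ?_⟩ <;>
        simp [five_eq_zero, e_bracket, e_basis, h1, h2, h3, h4, h5, hx1, hy1, hx4, hy4]
      all_goals ring
    · rw [Submodule.span_singleton_le_iff_mem]
      have : r • F 4 - F 5 = (-1 / 2 : ℝ) • ⁅F 2, F 3⁆ := by
        refine ext_coord F ?_ ?_ ?_ ?_ ?_ <;>
          simp [five_eq_zero, e_bracket, e_basis, h1, h2, h3, h4, h5]
        all_goals ring
      rw [this]
      refine Submodule.smul_mem _ _ (mem_derived_succ ?_ ?_) <;> rw [D1]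
      · exact Submodule.subset_span (by simp)
      · exact Submodule.subset_span (by simp)
  exact ⟨D1, D2, derived_succ_eq_bot_of_singleton D2⟩

theorem Family3.derived {a r : ℝ} (r0 : r ≠ 0) (h : Family3 F a r) :
    derived g 1 = Submodule.span ℝ {r • F 2 + a • F 3, F 4, F 5} ∧ derived g 2 = ⊥ := by
  obtain ⟨h1, h2, h3, h4, h5⟩ := h
  rw [h2] at h3
  have h1 (x y) := LinearMap.congr_fun₂ h1 x y
  have h2 (x y) := LinearMap.congr_fun₂ h2 x y
  have h3 (x y) := LinearMap.congr_fun₂ h3 x y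
  have h4 (x y) := LinearMap.congr_fun₂ h4 x y
  have h5 (x y) := LinearMap.congr_fun₂ h5 x y
  simp only [five_eq_zero, LinearMap.add_apply, LinearMap.sub_apply, LinearMap.smul_apply,
    LinearMap.zero_apply, smul_eq_mul, ee_apply] at h1 h2 h3 h4 h5
  have D1 : HypoContact.derived g 1 = Submodule.span ℝ {r • F 2 + a • F 3, F 4, F 5} := by
    refine le_antisymm (derived_one_le fun x y => ?_) (span_le_of_three ?_ ?_ ?_)
    · refine Submodule.mem_span_triple.2 ⟨e F 2 ⁅x, y⁆ / r,
        e F 4 ⁅x, y⁆,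
        e F 5 ⁅x, y⁆, ext_coord F ?_ ?_ ?_ ?_ ?_⟩ <;>
        simp [five_eq_zero, e_bracket, e_basis, h1, h2, h3, h4, h5]
      all_goals field_simp
      all_goals ring
    · have : r • F 2 + a • F 3 = (-1 / r) • ⁅F 3, F 5⁆ := by
        refine ext_coord F ?_ ?_ ?_ ?_ ?_ <;>
          simp [five_eq_zero, e_bracket, e_basis, h1, h2, h3, h4, h5]
        all_goals field_simp
      rw [this]
      exact Submodule.smul_mem _ _ (lie_mem_derived_one _ _)
    · have : F 4 = (-1 / r) • ⁅F 1, F 2⁆ := by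
        refine ext_coord F ?_ ?_ ?_ ?_ ?_ <;>
          simp [five_eq_zero, e_bracket, e_basis, h1, h2, h3, h4, h5]
        all_goals field_simp
      rw [this]
      exact Submodule.smul_mem _ _ (lie_mem_derived_one _ _)
    · have : F 5 = (1 / 2 : ℝ) • ⁅F 1, F 4⁆ - (1 / (2 * r)) • ⁅F 3, F 5⁆ := by
        refine ext_coord F ?_ ?_ ?_ ?_ ?_ <;>
          simp [five_eq_zero, e_bracket, e_basis, h1, h2, h3, h4, h5]
        all_goals field_simp
        all_goals ring
      rw [this]
      exact sub_mem (Submodule.smul_mem _ _ (lie_mem_derived_one _ _))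
        (Submodule.smul_mem _ _ (lie_mem_derived_one _ _))
  refine ⟨D1, derived_succ_eq_bot_of_triple D1 ?_ ?_ ?_⟩
  · refine ext_coord F ?_ ?_ ?_ ?_ ?_ <;>
      simp [five_eq_zero, e_bracket, e_basis, h1, h2, h3, h4, h5]
    all_goals ring
  · refine ext_coord F ?_ ?_ ?_ ?_ ?_ <;>
      simp [five_eq_zero, e_bracket, e_basis, h1, h2, h3, h4, h5]
    all_goals ring
  · refine ext_coord F ?_ ?_ ?_ ?_ ?_ <;>
      simp [five_eq_zero, e_bracket, e_basis, h1, h2, h3, h4, h5]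

theorem Family4.derived {a b : ℝ} (hab : a ≠ 0 ∨ b ≠ 0) (h : Family4 F a b) :
    derived g 1 = Submodule.span ℝ {F 3, F 4, F 5} ∧ derived g 2 = ⊥ := by
  have hn : a ^ 2 + b ^ 2 ≠ 0 := by
    rcases hab with h0 | h0 <;> positivity
  obtain ⟨h1, h2, h3, h4, h5⟩ := h
  have h1 (x y) := LinearMap.congr_fun₂ h1 x y
  have h2 (x y) := LinearMap.congr_fun₂ h2 x y
  have h3 (x y) := LinearMap.congr_fun₂ h3 x y
  have h4 (x y) := LinearMap.congr_fun₂ h4 x y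
  have h5 (x y) := LinearMap.congr_fun₂ h5 x y
  simp only [five_eq_zero, LinearMap.add_apply, LinearMap.sub_apply, LinearMap.smul_apply,
    LinearMap.zero_apply, smul_eq_mul, ee_apply] at h1 h2 h3 h4 h5
  have D1 : HypoContact.derived g 1 = Submodule.span ℝ {F 3, F 4, F 5} := by
    refine le_antisymm (derived_one_le fun x y => ?_) (span_le_of_three ?_ ?_ ?_)
    · refine Submodule.mem_span_triple.2 ⟨e F 3 ⁅x, y⁆,
        e F 4 ⁅x, y⁆,
        e F 5 ⁅x, y⁆, ext_coord F ?_ ?_ ?_ ?_ ?_⟩ <;>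
        simp [five_eq_zero, e_bracket, e_basis, h1, h2, h3, h4, h5]
    · have : F 3 = (1 / (a ^ 2 + b ^ 2)) • ⁅F 2, F 5⁆ := by
        refine ext_coord F ?_ ?_ ?_ ?_ ?_ <;>
          simp [five_eq_zero, e_bracket, e_basis, h1, h2, h3, h4, h5]
        all_goals field_simp
      rw [this]
      exact Submodule.smul_mem _ _ (lie_mem_derived_one _ _)
    · have : F 4 = (1 / (a ^ 2 + b ^ 2)) • ⁅F 1, F 5⁆ := by
        refine ext_coord F ?_ ?_ ?_ ?_ ?_ <;>
          simp [five_eq_zero, e_bracket, e_basis, h1, h2, h3, h4, h5]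
        all_goals field_simp
      rw [this]
      exact Submodule.smul_mem _ _ (lie_mem_derived_one _ _)
    · have : F 5 = (1 / 2 : ℝ) • ⁅F 1, F 4⁆ + (b / (2 * (a ^ 2 + b ^ 2))) • ⁅F 2, F 5⁆
          - (a / (2 * (a ^ 2 + b ^ 2))) • ⁅F 1, F 5⁆ := by
        refine ext_coord F ?_ ?_ ?_ ?_ ?_ <;>
          simp [five_eq_zero, e_bracket, e_basis, h1, h2, h3, h4, h5]
        all_goals field_simp
        all_goals ring
      rw [this]
      exact sub_mem (add_mem (Submodule.smul_mem _ _ (lie_mem_derived_one _ _))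
        (Submodule.smul_mem _ _ (lie_mem_derived_one _ _)))
        (Submodule.smul_mem _ _ (lie_mem_derived_one _ _))
  refine ⟨D1, derived_succ_eq_bot_of_triple D1 ?_ ?_ ?_⟩
  · refine ext_coord F ?_ ?_ ?_ ?_ ?_ <;>
      simp [five_eq_zero, e_bracket, e_basis, h1, h2, h3, h4, h5]
  · refine ext_coord F ?_ ?_ ?_ ?_ ?_ <;>
      simp [five_eq_zero, e_bracket, e_basis, h1, h2, h3, h4, h5]
  · refine ext_coord F ?_ ?_ ?_ ?_ ?_ <;>
      simp [five_eq_zero, e_bracket, e_basis, h1, h2, h3, h4, h5]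

theorem Family5.derived {r : ℝ} (r0 : r ≠ 0) (h : Family5 F r) :
    derived g 1 = Submodule.span ℝ {F 2, F 3, F 4, F 5} ∧
      derived g 2 = Submodule.span ℝ {F 2, r • F 4 - (2 : ℝ) • F 5} ∧ derived g 3 = ⊥ := by
  obtain ⟨h1, h2, h3, h4, h5⟩ := h
  have h1 (x y) := LinearMap.congr_fun₂ h1 x y
  have h2 (x y) := LinearMap.congr_fun₂ h2 x y
  have h3 (x y) := LinearMap.congr_fun₂ h3 x y
  have h4 (x y) := LinearMap.congr_fun₂ h4 x y
  have h5 (x y) := LinearMap.congr_fun₂ h5 x y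
  simp only [five_eq_zero, LinearMap.add_apply, LinearMap.sub_apply, LinearMap.smul_apply,
    LinearMap.zero_apply, smul_eq_mul, ee_apply] at h1 h2 h3 h4 h5
  have D1 : HypoContact.derived g 1 = Submodule.span ℝ {F 2, F 3, F 4, F 5} := by
    refine le_antisymm ?_ (span_le_of_four ?_ ?_ ?_ ?_)
    · rw [span_two_three_four_five]
      exact derived_one_le fun x y => by simp [e_bracket, h1]
    · have : F 2 = (-1 / r) • ⁅F 3, F 4⁆ := by
        refine ext_coord F ?_ ?_ ?_ ?_ ?_ <;>
          simp [five_eq_zero, e_bracket, e_basis, h1, h2, h3, h4, h5]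
        all_goals field_simp
      rw [this]
      exact Submodule.smul_mem _ _ (lie_mem_derived_one _ _)
    · have : F 3 = (-1 / r) • ⁅F 1, F 3⁆ := by
        refine ext_coord F ?_ ?_ ?_ ?_ ?_ <;>
          simp [five_eq_zero, e_bracket, e_basis, h1, h2, h3, h4, h5]
        all_goals field_simp
      rw [this]
      exact Submodule.smul_mem _ _ (lie_mem_derived_one _ _)
    · have : F 4 = (2 / r ^ 2) • ⁅F 1, F 5⁆ := by
        refine ext_coord F ?_ ?_ ?_ ?_ ?_ <;>
          simp [five_eq_zero, e_bracket, e_basis, h1, h2, h3, h4, h5]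
        all_goals field_simp
      rw [this]
      exact Submodule.smul_mem _ _ (lie_mem_derived_one _ _)
    · have : F 5 = (1 / 2 : ℝ) • ⁅F 1, F 4⁆ := by
        refine ext_coord F ?_ ?_ ?_ ?_ ?_ <;>
          simp [five_eq_zero, e_bracket, e_basis, h1, h2, h3, h4, h5]
      rw [this]
      exact Submodule.smul_mem _ _ (lie_mem_derived_one _ _)
  have D2 : HypoContact.derived g 2 = Submodule.span ℝ {F 2, r • F 4 - (2 : ℝ) • F 5} := by
    refine le_antisymm (derived_succ_le fun x hx y hy => ?_) (span_le_of_two ?_ ?_)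
    · rw [D1, span_two_three_four_five, LinearMap.mem_ker] at hx hy
      refine Submodule.mem_span_pair.2
        ⟨e F 2 ⁅x, y⁆, -(e F 2 x * e F 3 y - e F 3 x * e F 2 y),
          ext_coord F ?_ ?_ ?_ ?_ ?_⟩ <;>
        simp [five_eq_zero, e_bracket, e_basis, h1, h2, h3, h4, h5, hx, hy]
      all_goals field_simp
      all_goals ring
    · have : F 2 = (-1 / r) • ⁅F 3, F 4⁆ := by
        refine ext_coord F ?_ ?_ ?_ ?_ ?_ <;>
          simp [five_eq_zero, e_bracket, e_basis, h1, h2, h3, h4, h5]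
        all_goals field_simp
      rw [this]
      refine Submodule.smul_mem _ _ (mem_derived_succ ?_ ?_) <;> rw [D1]
      · exact Submodule.subset_span (by simp)
      · exact Submodule.subset_span (by simp)
    · have : r • F 4 - (2 : ℝ) • F 5 = (-1 : ℝ) • ⁅F 2, F 3⁆ := by
        refine ext_coord F ?_ ?_ ?_ ?_ ?_ <;>
          simp [five_eq_zero, e_bracket, e_basis, h1, h2, h3, h4, h5]
      rw [this]
      refine Submodule.smul_mem _ _ (mem_derived_succ ?_ ?_) <;> rw [D1]
      · exact Submodule.subset_span (by simp)
      · exact Submodule.subset_span (by simp)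
  refine ⟨D1, D2, derived_succ_eq_bot_of_pair D2 ?_⟩
  refine ext_coord F ?_ ?_ ?_ ?_ ?_ <;>
    simp [five_eq_zero, e_bracket, e_basis, h1, h2, h3, h4, h5]

theorem Family6.derived {r a : ℝ} (r0 : r ≠ 0) (h : Family6 F r a) :
    derived g 1 = Submodule.span ℝ {F 2, F 3, F 4, F 5} ∧
      derived g 2 = Submodule.span ℝ
        {a • F 2 - r • F 3, (r ^ 2 + a ^ 2) • F 4 - (2 * r) • F 5} ∧ derived g 3 = ⊥ := by
  have hn : r ^ 2 + a ^ 2 ≠ 0 := by positivity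
  obtain ⟨h1, h2, h3, h4, h5⟩ := h
  have h1 (x y) := LinearMap.congr_fun₂ h1 x y
  have h2 (x y) := LinearMap.congr_fun₂ h2 x y
  have h3 (x y) := LinearMap.congr_fun₂ h3 x y
  have h4 (x y) := LinearMap.congr_fun₂ h4 x y
  have h5 (x y) := LinearMap.congr_fun₂ h5 x y
  simp only [five_eq_zero, LinearMap.add_apply, LinearMap.sub_apply, LinearMap.smul_apply,
    LinearMap.zero_apply, smul_eq_mul, ee_apply] at h1 h2 h3 h4 h5
  have D1 : HypoContact.derived g 1 = Submodule.span ℝ {F 2, F 3, F 4, F 5} := by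
    refine le_antisymm ?_ (span_le_of_four ?_ ?_ ?_ ?_)
    · rw [span_two_three_four_five]
      exact derived_one_le fun x y => by simp [e_bracket, h1]
    · have : F 2 = (-r / (r ^ 2 + a ^ 2)) • ⁅F 1, F 2⁆ - (a / (r ^ 2 + a ^ 2)) • ⁅F 2, F 4⁆ := by
        refine ext_coord F ?_ ?_ ?_ ?_ ?_ <;>
          simp [five_eq_zero, e_bracket, e_basis, h1, h2, h3, h4, h5]
        all_goals field_simp
        all_goals ring
      rw [this]
      exact sub_mem (Submodule.smul_mem _ _ (lie_mem_derived_one _ _))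
        (Submodule.smul_mem _ _ (lie_mem_derived_one _ _))
    · have : F 3 = (-a / (r ^ 2 + a ^ 2)) • ⁅F 1, F 2⁆ + (r / (r ^ 2 + a ^ 2)) • ⁅F 2, F 4⁆ := by
        refine ext_coord F ?_ ?_ ?_ ?_ ?_ <;>
          simp [five_eq_zero, e_bracket, e_basis, h1, h2, h3, h4, h5]
        all_goals field_simp
        all_goals ring
      rw [this]
      exact add_mem (Submodule.smul_mem _ _ (lie_mem_derived_one _ _))
        (Submodule.smul_mem _ _ (lie_mem_derived_one _ _))
    · have : F 4 = (2 * r ^ 2 / (r ^ 2 + a ^ 2) ^ 2) • ⁅F 1, F 5⁆ := by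
        refine ext_coord F ?_ ?_ ?_ ?_ ?_ <;>
          simp [five_eq_zero, e_bracket, e_basis, h1, h2, h3, h4, h5]
        all_goals field_simp
      rw [this]
      exact Submodule.smul_mem _ _ (lie_mem_derived_one _ _)
    · have : F 5 = (1 / 2 : ℝ) • ⁅F 1, F 4⁆ := by
        refine ext_coord F ?_ ?_ ?_ ?_ ?_ <;>
          simp [five_eq_zero, e_bracket, e_basis, h1, h2, h3, h4, h5]
      rw [this]
      exact Submodule.smul_mem _ _ (lie_mem_derived_one _ _)
  have D2 : HypoContact.derived g 2 = Submodule.span ℝ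
      {a • F 2 - r • F 3, (r ^ 2 + a ^ 2) • F 4 - (2 * r) • F 5} := by
    refine le_antisymm (derived_succ_le fun x hx y hy => ?_) (span_le_of_two ?_ ?_)
    · rw [D1, span_two_three_four_five, LinearMap.mem_ker] at hx hy
      refine Submodule.mem_span_pair.2
        ⟨-e F 3 ⁅x, y⁆ / r, -(e F 2 x * e F 3 y - e F 3 x * e F 2 y) / r,
          ext_coord F ?_ ?_ ?_ ?_ ?_⟩ <;>
        simp [five_eq_zero, e_bracket, e_basis, h1, h2, h3, h4, h5, hx, hy]
      all_goals field_simp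
      all_goals ring
    · have : a • F 2 - r • F 3 = (-1 : ℝ) • ⁅F 2, F 4⁆ := by
        refine ext_coord F ?_ ?_ ?_ ?_ ?_ <;>
          simp [five_eq_zero, e_bracket, e_basis, h1, h2, h3, h4, h5]
      rw [this]
      refine Submodule.smul_mem _ _ (mem_derived_succ ?_ ?_) <;> rw [D1]
      · exact Submodule.subset_span (by simp)
      · exact Submodule.subset_span (by simp)
    · have : (r ^ 2 + a ^ 2) • F 4 - (2 * r) • F 5 = (-r) • ⁅F 2, F 3⁆ := by
        refine ext_coord F ?_ ?_ ?_ ?_ ?_ <;>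
          simp [five_eq_zero, e_bracket, e_basis, h1, h2, h3, h4, h5]
        all_goals field_simp
      rw [this]
      refine Submodule.smul_mem _ _ (mem_derived_succ ?_ ?_) <;> rw [D1]
      · exact Submodule.subset_span (by simp)
      · exact Submodule.subset_span (by simp)
  refine ⟨D1, D2, derived_succ_eq_bot_of_pair D2 ?_⟩
  refine ext_coord F ?_ ?_ ?_ ?_ ?_ <;>
    simp [five_eq_zero, e_bracket, e_basis, h1, h2, h3, h4, h5]
  all_goals field_simp
  all_goals ring

end families

end HypoContact

theorem proposition3p3 {g : Type*} [LieRing g] [LieAlgebra ℝ g] [LieAlgebra.IsSolvable g]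
    (η : Module.Dual ℝ g) (ω₁ ω₂ ω₃ : LinearMap.BilinForm ℝ g)
    (hη : HypoContact.IsHypoContact η ω₁ ω₂ ω₃)
    (E : Module.Basis (Fin 5) ℝ g) (hE : HypoContact.IsAdapted E η ω₁ ω₂ ω₃)
    (hd : HypoContact.GeneralEquations E) :
    (∃ F : Module.Basis (Fin 5) ℝ g, HypoContact.IsAdapted F η ω₁ ω₂ ω₃ ∧
      ((∃ r : ℝ, r ≠ 0 ∧ HypoContact.Family1 F r) ∨
       (∃ r : ℝ, r ≠ 0 ∧ HypoContact.Family2 F r) ∨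
       (∃ a r : ℝ, r ≠ 0 ∧ HypoContact.Family3 F a r) ∨
       (∃ a b : ℝ, HypoContact.Family4 F a b) ∨
       (∃ r : ℝ, r ≠ 0 ∧ HypoContact.Family5 F r) ∨
       (∃ r a : ℝ, r ≠ 0 ∧ HypoContact.Family6 F r a))) ∧
    (∀ F : Module.Basis (Fin 5) ℝ g,
      (∀ r : ℝ, r ≠ 0 → HypoContact.Family1 F r →
        HypoContact.derived g 1 = Submodule.span ℝ {F 2, F 3, F 4, F 5} ∧
        HypoContact.derived g 2 = Submodule.span ℝ {r • F 4 - F 5} ∧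
        HypoContact.derived g 3 = ⊥) ∧
      (∀ r : ℝ, r ≠ 0 → HypoContact.Family2 F r →
        HypoContact.derived g 1 = Submodule.span ℝ {F 2, F 3, r • F 4 - F 5} ∧
        HypoContact.derived g 2 = Submodule.span ℝ {r • F 4 - F 5} ∧
        HypoContact.derived g 3 = ⊥) ∧
      (∀ a r : ℝ, r ≠ 0 → HypoContact.Family3 F a r →
        HypoContact.derived g 1 = Submodule.span ℝ {r • F 2 + a • F 3, F 4, F 5} ∧
        HypoContact.derived g 2 = ⊥) ∧
      (∀ a b : ℝ, (a ≠ 0 ∨ b ≠ 0) → HypoContact.Family4 F a b →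
        HypoContact.derived g 1 = Submodule.span ℝ {F 3, F 4, F 5} ∧
        HypoContact.derived g 2 = ⊥) ∧
      (∀ r : ℝ, r ≠ 0 → HypoContact.Family5 F r →
        HypoContact.derived g 1 = Submodule.span ℝ {F 2, F 3, F 4, F 5} ∧
        HypoContact.derived g 2 = Submodule.span ℝ {F 2, r • F 4 - (2 : ℝ) • F 5} ∧
        HypoContact.derived g 3 = ⊥) ∧
      (∀ r a : ℝ, r ≠ 0 → HypoContact.Family6 F r a →
        HypoContact.derived g 1 = Submodule.span ℝ {F 2, F 3, F 4, F 5} ∧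
        HypoContact.derived g 2 =
          Submodule.span ℝ {a • F 2 - r • F 3, (r ^ 2 + a ^ 2) • F 4 - (2 * r) • F 5} ∧
        HypoContact.derived g 3 = ⊥)) := by
  refine ⟨?_, fun F => ⟨fun r r0 h => h.derived r0, fun r r0 h => h.derived r0,
    fun a r r0 h => h.derived r0, fun a b hab h => h.derived hab, fun r r0 h => h.derived r0,
    fun r a r0 h => h.derived r0⟩⟩
  obtain ⟨F, hF, hF1⟩ := hd.exists_closed hE
  exact hη.exists_inSomeFamily_of_closed hF hF1
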